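/- **Setting.** Orbifolds are smooth, effective, finite-dimensional and Hausdorff. Let $G$ be a connected Lie group with Lie algebra $\mathfrak g$, let $\mathfrak r$ be the radical of $\mathfrak g$, and let $[\mathfrak g,\mathfrak g]^\circ\subset\mathfrak g^*$ be the annihilator of $[\mathfrak g,\mathfrak g]$. Let $(M,\omega)$ be a connected symplectic orbifold with a smooth $G$-action that preserves $\omega$. Let $p:\widetilde M\to M$ be the universal (branched) covering orbifold and $\Gamma=\pi_1^{\rm orb}(M)$ the orbifold fundamental group of $M$, acting on $\widetilde M$ as the group of deck transformations of $p$. Suppose that the $G$-action lifts to a smooth $G$-action on $\widetilde M$ (so that $p(gx)=g\,p(x)$), and put $\widetilde\omega=p^*\omega$. A *momentum map* on a $G$-orbifold $X$ with invariant symplectic form $\sigma$ is a smooth map $J:X\to\mathfrak g^*$ with $i(\xi_X)\sigma=d\langle J,\xi\rangle$ for all $\xi\in\mathfrak g$, where $\xi_X$ is the infinitesimal generator of the action corresponding to $\xi$; it is *equivariant* if it intertwines the $G$-action on $X$ and the coadjoint action on $\mathfrak g^*$. Let $\widetilde J:\widetilde M\to\mathfrak g^*$ be a momentum map for $(\widetilde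 M,\widetilde\omega)$. **Proposition.** Suppose that the actions of $G$ and $\Gamma$ on $\widetilde M$ commute. 1. There is a homomorphism $h:\Gamma\to\mathfrak g^*$ into the additive group of $\mathfrak g^*$ such that $$\widetilde J(\gamma x)-\widetilde J(x)=h(\gamma)\qquad\text{for all }\gamma\in\Gamma,\ x\in\widetilde M.$$ 2. If $\widetilde J$ is $G$-equivariant, then $h(\Gamma)\subset[\mathfrak g,\mathfrak g]^\circ$. Moreover, if $\mathfrak g=[\mathfrak g,\mathfrak g]\oplus\mathfrak r$, then restriction of functionals to $\mathfrak r$ is an isomorphism $[\mathfrak g,\mathfrak g]^\circ\cong\mathfrak r^*$. 3. If $G$ is semisimple (that is, $\mathfrak r=0$), then there is a momentum map $J:M\to\mathfrak g^*$ for $(M,\omega)$ with $\widetilde J=J\circ p$; if $\widetilde J$ is $G$-equivariant, then so is $J$. -/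

import Mathlib

open Set Topology
open scoped Manifold ContDiff

universe u

noncomputable section

namespace OrbifoldGeometry

/-! ### Smooth effective orbifolds (local uniformizing charts) -/

section Orbifolds

/-- An orbifold chart (uniformizing chart) on `X`: a connected open set `dom` of the model vector
space `E`, a finite group `Grp` acting effectively on `dom` by diffeomorphisms, and a map `proj`
from `dom` to `X` that induces a homeomorphism of the quotient `dom / Grp` onto an open subset
of `X`. (Values of `act g` and of `proj` outside `dom` are irrelevant.) -/
structure OrbifoldChart (E : Type*) [NormedAddCommGroup E] [NormedSpace ℝ E]
    (X : Type*) [TopologicalSpace X] where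
  dom : Set E
  isOpen_dom : IsOpen dom
  isConnected_dom : IsConnected dom
  Grp : Type
  [group : Group Grp]
  [finite : Finite Grp]
  act : Grp → E → E
  act_mapsTo : ∀ g, MapsTo (act g) dom dom
  act_one : ∀ w ∈ dom, act 1 w = w
  act_mul : ∀ g h, ∀ w ∈ dom, act (g * h) w = act g (act h w)
  act_effective : ∀ g, (∀ w ∈ dom, act g w = w) → g = 1
  act_smooth : ∀ g, ContDiffOn ℝ ∞ (act g) dom
  proj : E → X
  proj_continuousOn : ContinuousOn proj dom
  proj_open : ∀ A, A ⊆ dom → IsOpen A → IsOpen (proj '' A)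
  proj_eq_iff : ∀ w ∈ dom, ∀ w' ∈ dom, proj w = proj w' ↔ ∃ g, act g w = w'

attribute [instance] OrbifoldChart.group OrbifoldChart.finite

variable {E : Type*} [NormedAddCommGroup E] [NormedSpace ℝ E]
  {X : Type*} [TopologicalSpace X] {Y : Type*} [TopologicalSpace Y]
  {Z : Type*} [TopologicalSpace Z]

/-- The open subset of `X` uniformized by the chart. -/
def OrbifoldChart.image (c : OrbifoldChart E X) : Set X := c.proj '' c.dom

/-- `φ`, defined on the open set `A`, is a smooth lift of `f : X → Y` to the charts `c`, `c'`. -/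
structure IsLocalLift (c : OrbifoldChart E X) (c' : OrbifoldChart E Y) (f : X → Y)
    (A : Set E) (φ : E → E) : Prop where
  isOpen : IsOpen A
  subset : A ⊆ c.dom
  mapsTo : MapsTo φ A c'.dom
  smooth : ContDiffOn ℝ ∞ φ A
  comm : ∀ w ∈ A, c'.proj (φ w) = f (c.proj w)

/-- Two charts are compatible if any two points of their domains that lie over the same point
of `X` are matched by a change of charts: a diffeomorphism between neighbourhoods of these points
that commutes with the projections to `X`. -/
def ChartCompatible (c c' : OrbifoldChart E X) : Prop :=
  ∀ v ∈ c.dom, ∀ v' ∈ c'.dom, c.proj v = c'.proj v' →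
    ∃ φ : OpenPartialHomeomorph E E, v ∈ φ.source ∧ φ v = v' ∧
      IsLocalLift c c' id φ.source φ ∧ ContDiffOn ℝ ∞ φ.symm φ.target

variable (E X) in
/-- A smooth effective orbifold structure, modelled on `E`, on the (Hausdorff) space `X`: an atlas
of pairwise compatible orbifold charts whose images cover `X`. -/
class Orbifold where
  atlas : Set (OrbifoldChart E X)
  exists_chart : ∀ x : X, ∃ c ∈ atlas, x ∈ c.image
  compatible : ∀ c ∈ atlas, ∀ c' ∈ atlas, ChartCompatible c c'

variable (E X) in
/-- All charts compatible with those of the given atlas. -/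
def maximalAtlas [Orbifold E X] : Set (OrbifoldChart E X) :=
  {c | ∀ c' ∈ Orbifold.atlas (E := E) (X := X), ChartCompatible c c'}

variable (E) in
/-- A point is regular (nonsingular) if its isotropy group is trivial. -/
def IsRegularPoint [Orbifold E X] (x : X) : Prop :=
  ∃ c ∈ Orbifold.atlas (E := E) (X := X), ∃ w ∈ c.dom, c.proj w = x ∧
    ∀ g : c.Grp, c.act g w = w → g = 1

variable (E) in
/-- Smooth maps of orbifolds: every point has a smooth local lift to charts.
(Continuity of `f` follows, chart projections being continuous and open.) -/
def OrbifoldSmooth [Orbifold E X] [Orbifold E Y] (f : X → Y) : Prop :=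
  ∀ c ∈ Orbifold.atlas (E := E) (X := X), ∀ c' ∈ Orbifold.atlas (E := E) (X := Y),
    ∀ v ∈ c.dom, ∀ v' ∈ c'.dom, f (c.proj v) = c'.proj v' →
      ∃ (A : Set E) (φ : E → E), v ∈ A ∧ φ v = v' ∧ IsLocalLift c c' f A φ

theorem orbifoldSmooth_id [Orbifold E X] : OrbifoldSmooth E (id : X → X) := by
  intro c hc c' hc' v hv v' hv' h
  obtain ⟨φ, h1, h2, h3, -⟩ := Orbifold.compatible c hc c' hc' v hv v' hv' h
  exact ⟨φ.source, φ, h1, h2, h3⟩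

theorem OrbifoldSmooth.comp [Orbifold E X] [Orbifold E Y] [Orbifold E Z] {f : X → Y} {k : Y → Z}
    (hk : OrbifoldSmooth E k) (hf : OrbifoldSmooth E f) : OrbifoldSmooth E (k ∘ f) := by
  intro c hc c' hc' v hv v' hv' h
  obtain ⟨d, hd, z, hz, hzf⟩ := Orbifold.exists_chart (E := E) (f (c.proj v))
  obtain ⟨A, φ, hvA, hφ, hL⟩ := hf c hc d hd v hv z hz hzf.symm
  have hkz : k (d.proj z) = c'.proj v' := by rw [hzf]; exact h
  obtain ⟨B, ψ, hzB, hψ, hL'⟩ := hk d hd c' hc' z hz v' hv' hkz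
  have hcont : ContinuousOn φ A := hL.smooth.continuousOn
  refine ⟨A ∩ φ ⁻¹' B, ψ ∘ φ, ⟨hvA, by simpa [hφ] using hzB⟩, by simp [hφ, hψ], ?_⟩
  refine ⟨hcont.isOpen_inter_preimage hL.isOpen hL'.isOpen, fun w hw => hL.subset hw.1,
    fun w hw => hL'.mapsTo hw.2, ?_, ?_⟩
  · exact hL'.smooth.comp (hL.smooth.mono inter_subset_left) (fun w hw => hw.2)
  · intro w hw
    simp only [Function.comp_apply]
    rw [hL'.comm _ hw.2, hL.comm _ hw.1]

end Orbifolds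

/-! ### Covering orbifolds, universal covering, orbifold fundamental group -/

section Coverings

variable (E : Type*) [NormedAddCommGroup E] [NormedSpace ℝ E]

/-- Covering orbifolds (branched coverings): every point of `X` has a neighbourhood
`U = Ũ / Grp`, given by a chart `c`, such that each connected component `V` of `p ⁻¹ U` is
isomorphic over `U` to `Ũ / H` for a subgroup `H` of `Grp`, that is, `V` is the image of a chart
`d` with the same domain `Ũ` whose group `H` acts through an inclusion `i` into `Grp`, and
`p ∘ d.proj = c.proj` on `Ũ`. -/
def IsOrbifoldCovering {N : Type*} [TopologicalSpace N] [Orbifold E N]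
    {X : Type*} [TopologicalSpace X] [Orbifold E X] (p : N → X) : Prop :=
  ∀ x : X, ∃ c ∈ maximalAtlas E X, x ∈ c.image ∧
    ∀ y ∈ p ⁻¹' c.image, ∃ d ∈ maximalAtlas E N, d.dom = c.dom ∧
      d.image = connectedComponentIn (p ⁻¹' c.image) y ∧
      (∃ i : d.Grp →* c.Grp, Function.Injective i ∧
        ∀ g, ∀ w ∈ d.dom, c.act (i g) w = d.act g w) ∧
      ∀ w ∈ d.dom, p (d.proj w) = c.proj w

/-- The universal covering orbifold: a connected covering orbifold that maps, as a covering and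
compatibly with base points (over regular points of `X`), to any other connected covering
orbifold of `X`. -/
structure IsUniversalCovering {Xt X : Type u} [TopologicalSpace Xt] [Orbifold E Xt]
    [TopologicalSpace X] [Orbifold E X] (p : Xt → X) : Prop where
  connected : ConnectedSpace Xt
  covering : IsOrbifoldCovering E p
  universal : ∀ (N : Type u) [TopologicalSpace N] [T2Space N] [ConnectedSpace N] [Orbifold E N]
    (q : N → X), IsOrbifoldCovering E q → ∀ (x : Xt) (y : N), p x = q y →
      IsRegularPoint E (p x) →
      ∃ r : Xt → N, IsOrbifoldCovering E r ∧ q ∘ r = p ∧ r x = y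

/-- The group of deck transformations of `p`: orbifold diffeomorphisms `γ` of the total space with
`p ∘ γ = p`. For the universal covering this is the orbifold fundamental group of the base. -/
def DeckGroup {N : Type*} [TopologicalSpace N] [Orbifold E N]
    {X : Type*} (p : N → X) : Subgroup (N ≃ₜ N) where
  carrier := {γ | OrbifoldSmooth E γ ∧ OrbifoldSmooth E γ.symm ∧ ∀ x, p (γ x) = p x}
  one_mem' := ⟨orbifoldSmooth_id, orbifoldSmooth_id, fun _ => rfl⟩
  mul_mem' := by
    rintro a b ⟨ha, ha', hap⟩ ⟨hb, hb', hbp⟩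
    exact ⟨ha.comp hb, hb'.comp ha', fun x => (hap (b x)).trans (hbp x)⟩
  inv_mem' := by
    rintro a ⟨ha, ha', hap⟩
    refine ⟨ha', ha, fun x => ?_⟩
    have h := hap (a.symm x)
    rw [a.apply_symm_apply] at h
    exact h.symm

end Coverings

/-! ### Differential forms on orbifolds -/

section Forms

variable {E : Type*} [NormedAddCommGroup E] [NormedSpace ℝ E]
  {X : Type*} [TopologicalSpace X] {Y : Type*} [TopologicalSpace Y]

/-- `α = f^* β` for families `α`, `β` of `k`-forms on the charts of `X` and `Y`: in all charts,
`α` is the pullback of `β` under every local lift of `f`. -/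
def IsPullback [Orbifold E X] [Orbifold E Y] {k : ℕ} (f : X → Y)
    (β : OrbifoldChart E Y → E → E [⋀^Fin k]→L[ℝ] ℝ)
    (α : OrbifoldChart E X → E → E [⋀^Fin k]→L[ℝ] ℝ) : Prop :=
  ∀ c ∈ Orbifold.atlas (E := E) (X := X), ∀ c' ∈ Orbifold.atlas (E := E) (X := Y),
    ∀ (A : Set E) (φ : E → E), IsLocalLift c c' f A φ →
      ∀ w ∈ A, α c w = (β c' (φ w)).compContinuousLinearMap (fderiv ℝ φ w)

variable (E X) in
/-- A smooth differential `k`-form on an orbifold: a smooth form on each chart of the atlas,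
compatible with all changes of charts, in particular invariant under the chart groups. -/
structure OrbifoldForm [Orbifold E X] (k : ℕ) where
  toFun : OrbifoldChart E X → E → E [⋀^Fin k]→L[ℝ] ℝ
  smooth : ∀ c ∈ Orbifold.atlas (E := E) (X := X), ContDiffOn ℝ ∞ (toFun c) c.dom
  compatible : IsPullback (id : X → X) toFun toFun

/-- A symplectic form: a closed nondegenerate 2-form. -/
structure IsSymplectic [Orbifold E X] (σ : OrbifoldForm E X 2) : Prop where
  closed : ∀ c ∈ Orbifold.atlas (E := E) (X := X), ∀ w ∈ c.dom, extDeriv (σ.toFun c) w = 0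
  nondegenerate : ∀ c ∈ Orbifold.atlas (E := E) (X := X), ∀ w ∈ c.dom, ∀ v : E,
    (∀ v' : E, σ.toFun c w ![v, v'] = 0) → v = 0

end Forms

/-! ### Lie group actions on orbifolds -/

section Actions

variable {EG : Type*} [NormedAddCommGroup EG] [NormedSpace ℝ EG]
  {G : Type*} [TopologicalSpace G] [ChartedSpace EG G] [Group G]
  {E : Type*} [NormedAddCommGroup E] [NormedSpace ℝ E]
  {X : Type*} [TopologicalSpace X] [MulAction G X]

variable (EG) in
/-- `F`, defined on the product of the open sets `W` of `G` and `A` of `c.dom`, is a smooth lift to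
the charts `c`, `c'` of the action map `G × X → X`. -/
structure IsActionLift (c c' : OrbifoldChart E X) (W : Set G) (A : Set E) (F : G × E → E) :
    Prop where
  isOpen_left : IsOpen W
  isOpen_right : IsOpen A
  subset : A ⊆ c.dom
  mapsTo : MapsTo F (W ×ˢ A) c'.dom
  smooth : ContMDiffOn ((𝓘(ℝ, EG)).prod 𝓘(ℝ, E)) 𝓘(ℝ, E) ∞ F (W ×ˢ A)
  comm : ∀ g ∈ W, ∀ w ∈ A, c'.proj (F (g, w)) = g • c.proj w

variable (EG G E X) in
/-- The action map `G × X → X` is a smooth map of orbifolds. -/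
def IsSmoothAction [Orbifold E X] : Prop :=
  ∀ c ∈ Orbifold.atlas (E := E) (X := X), ∀ c' ∈ Orbifold.atlas (E := E) (X := X),
    ∀ g : G, ∀ v ∈ c.dom, ∀ v' ∈ c'.dom, g • c.proj v = c'.proj v' →
      ∃ (W : Set G) (A : Set E) (F : G × E → E), g ∈ W ∧ v ∈ A ∧ F (g, v) = v' ∧
        IsActionLift EG c c' W A F

variable (G) in
/-- The action preserves the form `σ`. -/
def IsInvariantForm [Orbifold E X] {k : ℕ} (σ : OrbifoldForm E X k) : Prop :=
  ∀ g : G, IsPullback (fun x : X => g • x) σ.toFun σ.toFun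

/-- `v` is the value at `w`, in the chart `c`, of the infinitesimal generator of the action
that corresponds to the Lie algebra element `ξ`: the derivative at `g = 1` in the direction `ξ` of
`g ↦ F (g, w)`, where `F` is a local lift of the action that starts at the identity. -/
def IsGeneratorAt (c : OrbifoldChart E X) (w : E) (ξ : GroupLieAlgebra 𝓘(ℝ, EG) G) (v : E) :
    Prop :=
  ∃ (W : Set G) (A : Set E) (F : G × E → E), IsActionLift EG c c W A F ∧
    1 ∈ W ∧ w ∈ A ∧ (∀ z ∈ A, F (1, z) = z) ∧
    v = mfderiv 𝓘(ℝ, EG) 𝓘(ℝ, E) (fun g : G => F (g, w)) 1 ξ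

variable (EG G) in
/-- The dual of the Lie algebra of `G`. -/
abbrev LieDual : Type _ := Module.Dual ℝ (GroupLieAlgebra 𝓘(ℝ, EG) G)

/-- A momentum map for `σ`: a smooth map `J` to the dual of the Lie algebra such that
`i(ξ_X) σ = d J_ξ` for all `ξ`, where `J_ξ = ⟨J, ξ⟩` and `ξ_X` is the infinitesimal generator. -/
structure IsMomentumMap [Orbifold E X] (σ : OrbifoldForm E X 2) (J : X → LieDual EG G) :
    Prop where
  smooth : ∀ ξ : GroupLieAlgebra 𝓘(ℝ, EG) G, ∀ c ∈ Orbifold.atlas (E := E) (X := X),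
    ContDiffOn ℝ ∞ (fun w => J (c.proj w) ξ) c.dom
  generates : ∀ ξ : GroupLieAlgebra 𝓘(ℝ, EG) G, ∀ c ∈ Orbifold.atlas (E := E) (X := X),
    ∀ w ∈ c.dom, ∀ v : E, IsGeneratorAt c w ξ v →
      ∀ v' : E, σ.toFun c w ![v, v'] = fderiv ℝ (fun z => J (c.proj z) ξ) w v'

variable (EG) in
/-- The adjoint representation: the derivative at `1` of conjugation by `g`. -/
def Ad (g : G) : GroupLieAlgebra 𝓘(ℝ, EG) G →L[ℝ] GroupLieAlgebra 𝓘(ℝ, EG) G :=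
  mfderiv 𝓘(ℝ, EG) 𝓘(ℝ, EG) (fun k : G => g * k * g⁻¹) 1

/-- The coadjoint action of `G` on the dual of its Lie algebra: `⟨Ad*_g μ, ξ⟩ = ⟨μ, Ad_{g⁻¹} ξ⟩`. -/
def coAd (g : G) (μ : LieDual EG G) : LieDual EG G :=
  μ ∘ₗ (Ad EG g⁻¹).toLinearMap

/-- `J` intertwines the action of `G` on `X` and the coadjoint action. -/
def IsCoadjointEquivariant (J : X → LieDual EG G) : Prop :=
  ∀ (g : G) (x : X), J (g • x) = coAd g (J x)

/-- A smooth Lie group is regular enough for the Lie bracket on its tangent space at `1` to satisfy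
the laws of a Lie algebra. -/
instance instLieGroupMinSmoothness [LieGroup 𝓘(ℝ, EG) ∞ G] :
    LieGroup 𝓘(ℝ, EG) (minSmoothness ℝ 3) G := by
  rw [minSmoothness_of_isRCLikeNormedField]
  infer_instance

variable (EG G) in
/-- The derived algebra `[𝔤, 𝔤]`. -/
abbrev derivedAlg [CompleteSpace EG] [LieGroup 𝓘(ℝ, EG) ∞ G] : LieIdeal ℝ (GroupLieAlgebra 𝓘(ℝ, EG) G) :=
  ⁅(⊤ : LieIdeal ℝ (GroupLieAlgebra 𝓘(ℝ, EG) G)), (⊤ : LieIdeal ℝ (GroupLieAlgebra 𝓘(ℝ, EG) G))⁆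

variable (EG G) in
/-- The annihilator `[𝔤, 𝔤]°` of the derived algebra in the dual of the Lie algebra. -/
abbrev derivedAnnihilator [CompleteSpace EG] [LieGroup 𝓘(ℝ, EG) ∞ G] : Submodule ℝ (LieDual EG G) :=
  (derivedAlg EG G).toSubmodule.dualAnnihilator

variable (EG G) in
/-- The radical `𝔯` of the Lie algebra: its largest solvable ideal. -/
abbrev lieRadical [CompleteSpace EG] [LieGroup 𝓘(ℝ, EG) ∞ G] : LieIdeal ℝ (GroupLieAlgebra 𝓘(ℝ, EG) G) :=
  LieAlgebra.radical ℝ (GroupLieAlgebra 𝓘(ℝ, EG) G)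

variable (EG G) in
/-- Restriction of functionals in `[𝔤, 𝔤]°` to the radical `𝔯`. -/
def restrictToRadical [CompleteSpace EG] [LieGroup 𝓘(ℝ, EG) ∞ G] :
    derivedAnnihilator EG G →ₗ[ℝ] Module.Dual ℝ (lieRadical EG G) :=
  (lieRadical EG G).toSubmodule.dualRestrict ∘ₗ (derivedAnnihilator EG G).subtype

end Actions

end OrbifoldGeometry

end

/-! Let `f` be an open smooth self-map of the covering that preserves the form and satisfies `f (k •
x) = (a * k * a⁻¹) • f x`. It carries the generator of `ξ` to that of `Ad a ξ`, so the function `x ↦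
⟨J (f x), Ad a ξ⟩ - ⟨J x, ξ⟩` has zero differential and is constant on a connected orbifold
(`IsMomentumMap.comp_sub_eq_const`). For a deck transformation and `a = 1` the constant is `h(γ)`,
and additivity is telescoping. Taking also translation by `g` with `a = g` and comparing the
constants at `x` and `f x`, the displacement `J ∘ f - J` of a map `f` commuting with `G` is
`Ad`-invariant. An `Ad`-invariant functional has equal left- and right-invariant extensions to a
1-form near `1`; differentiating both invariances shows that it kills brackets, which puts `h(Γ)`
into the annihilator.

If the radical vanishes, the Lie algebra is perfect and every such displacement is zero. Two points
of a regular fibre are joined by a covering map `r` over the base, by the universal property; `r`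
need not be known to be invertible, so the displacement lemmas are stated for open smooth maps, and
`r` commutes with `G` because `G` is connected (`IsOrbifoldCovering.map_smul`). Hence the momentum
map is constant on regular fibres, by continuity on all fibres, and it descends.

Singular points are handled by density throughout. Local lifts are determined by their value at one
point where chart projections are locally injective, which holds over regular points. These are
dense, because a nontrivial element of a chart group cannot fix an open set, and identities between
continuous quantities extend from them. -/

namespace OrbifoldGeometry

open Filter

/-! ### Local injectivity -/

section LocalInjectivity

variable {X Y Z : Type*} [TopologicalSpace X]

/-- `p` is injective on a neighbourhood of `x`. -/
def LocInjAt (p : X → Y) (x : X) : Prop :=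
  ∀ᶠ q : X × X in 𝓝 (x, x), p q.1 = p q.2 → q.1 = q.2

theorem LocInjAt.eventually_eq {p : X → Y} {x : X} (h : LocInjAt p x) {l : Filter Z} {a b : Z → X}
    (ha : Tendsto a l (𝓝 x)) (hb : Tendsto b l (𝓝 x)) (hab : ∀ᶠ z in l, p (a z) = p (b z)) :
    ∀ᶠ z in l, a z = b z := by
  filter_upwards [(ha.prodMk_nhds hb).eventually h, hab] with z h1 h2 using h1 h2

theorem eventually_ne_of_tendsto [T2Space X] {l : Filter Z} {a b : Z → X} {x y : X}
    (ha : Tendsto a l (𝓝 x)) (hb : Tendsto b l (𝓝 y)) (h : x ≠ y) : ∀ᶠ z in l, a z ≠ b z :=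
  (ha.prodMk_nhds hb).eventually (isClosed_diagonal.isOpen_compl.mem_nhds (x := (x, y)) h)

theorem eq_of_frequently_eq_of_tendsto [T2Space X] {l : Filter Z} {a b : Z → X} {x y : X}
    (ha : Tendsto a l (𝓝 x)) (hb : Tendsto b l (𝓝 y)) (h : ∃ᶠ z in l, a z = b z) : x = y := by
  by_contra hne
  exact h (eventually_ne_of_tendsto ha hb hne)

end LocalInjectivity

/-! ### Chart groups, local lifts, and density of regular points. -/

section Charts

variable {E : Type*} [NormedAddCommGroup E] [NormedSpace ℝ E]
  {X : Type*} [TopologicalSpace X] {Y : Type*} [TopologicalSpace Y]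

namespace OrbifoldChart

variable (c : OrbifoldChart E X)

theorem dom_mem_nhds {w : E} (hw : w ∈ c.dom) : c.dom ∈ 𝓝 w := c.isOpen_dom.mem_nhds hw

theorem continuousAt_proj {w : E} (hw : w ∈ c.dom) : ContinuousAt c.proj w :=
  c.proj_continuousOn.continuousAt (c.dom_mem_nhds hw)

/-- Turns "eventually" and "frequently" statements near a point of the orbifold into statements in a
chart. -/
theorem map_proj_nhds {w : E} (hw : w ∈ c.dom) : map c.proj (𝓝 w) = 𝓝 (c.proj w) := by
  refine le_antisymm (c.continuousAt_proj hw) ?_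
  intro S hS
  obtain ⟨A, hAS, hA, hwA⟩ := mem_nhds_iff.1 (inter_mem hS (c.dom_mem_nhds hw))
  refine mem_of_superset ((c.proj_open A (fun z hz => (hAS hz).2) hA).mem_nhds
    (mem_image_of_mem _ hwA)) ?_
  rintro _ ⟨z, hz, rfl⟩
  exact (hAS hz).1

theorem isOpen_image : IsOpen c.image := c.proj_open _ Subset.rfl c.isOpen_dom

theorem proj_act (g : c.Grp) {w : E} (hw : w ∈ c.dom) : c.proj (c.act g w) = c.proj w :=
  ((c.proj_eq_iff w hw _ (c.act_mapsTo g hw)).2 ⟨g, rfl⟩).symm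

theorem contDiffAt_act (g : c.Grp) {w : E} (hw : w ∈ c.dom) : ContDiffAt ℝ ∞ (c.act g) w :=
  (c.act_smooth g).contDiffAt (c.dom_mem_nhds hw)

theorem act_pow_eventuallyEq {g : c.Grp} {w : E} (hw : w ∈ c.dom)
    (h : c.act g =ᶠ[𝓝 w] id) (k : ℕ) : c.act (g ^ k) =ᶠ[𝓝 w] id := by
  induction k with
  | zero =>
    filter_upwards [c.dom_mem_nhds hw] with z hz
    simpa using c.act_one z hz
  | succ k ih =>
    filter_upwards [c.dom_mem_nhds hw, h, ih] with z hz h1 h2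
    rw [pow_succ, c.act_mul _ _ z hz, h1]
    exact h2

/-- If all the powers of `g` have derivative `1` at `w`, then `g` is trivial near `w`. -/
theorem act_eventuallyEq_id_of_fderiv {g : c.Grp} {w : E} (hw : w ∈ c.dom) (hgw : c.act g w = w)
    (hd : ∀ k : ℕ, fderiv ℝ (c.act (g ^ k)) w = ContinuousLinearMap.id ℝ E) :
    c.act g =ᶠ[𝓝 w] id := by
  set n := orderOf g with hn
  have hnpos : 0 < n := orderOf_pos g
  -- Averaging over the cyclic group: `ψ` is `g`-invariant and has strict derivative `n • id` at
  -- `w`, hence is injective near `w`. This forces `g z = z`.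
  set ψ : E → E := fun z => ∑ k ∈ Finset.range n, c.act (g ^ k) z with hψ
  have hψd : HasStrictFDerivAt ψ (∑ k ∈ Finset.range n, ContinuousLinearMap.id ℝ E) w := by
    refine HasStrictFDerivAt.fun_sum fun k _ => ?_
    rw [← hd k]
    exact (c.contDiffAt_act _ hw).hasStrictFDerivAt (by simp)
  have hψg : ∀ z ∈ c.dom, ψ (c.act g z) = ψ z := by
    intro z hz
    have h1 : ∀ k, c.act (g ^ k) (c.act g z) = c.act (g ^ (k + 1)) z := fun k => by
      rw [pow_succ, c.act_mul _ _ z hz]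
    have h2 := Finset.sum_range_succ (fun k => c.act (g ^ k) z) n
    rw [Finset.sum_range_succ', hn, pow_orderOf_eq_one, pow_zero] at h2
    simpa only [hψ, h1] using add_right_cancel h2
  have hev := hψd.isLittleO.def (c := 1 / 2) (by norm_num)
  have hlim : Tendsto (fun z => (c.act g z, z)) (𝓝 w) (𝓝 (w, w)) := by
    have := (c.contDiffAt_act g hw).continuousAt
    rw [ContinuousAt, hgw] at this
    exact this.prodMk_nhds tendsto_id
  filter_upwards [hlim.eventually hev, c.dom_mem_nhds hw] with z h1 hz
  -- As `ψ (g z) = ψ z`, the strict derivative estimate reads `n ‖g z - z‖ ≤ ½ ‖g z - z‖`, with `n ≥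
  -- 1`.
  simp only [hψg z hz, sub_self, zero_sub, norm_neg, Finset.sum_const, Finset.card_range] at h1
  rw [← Nat.cast_smul_eq_nsmul ℝ] at h1
  simp only [FunLike.coe_smul, Pi.smul_apply, ContinuousLinearMap.id_apply,
    norm_smul, Real.norm_natCast] at h1
  have h2 : (1 : ℝ) ≤ n := by exact_mod_cast hnpos
  have h3 := norm_nonneg (c.act g z - z)
  have h4 : ‖c.act g z - z‖ = 0 := by nlinarith
  exact sub_eq_zero.1 (norm_eq_zero.1 h4)

/-- A chart group element that is trivial near a point is trivial. -/
theorem eq_one_of_act_eventuallyEq {g : c.Grp} {w : E} (hw : w ∈ c.dom)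
    (h : c.act g =ᶠ[𝓝 w] id) : g = 1 := by
  set S : Set E := {z | c.act g =ᶠ[𝓝 z] id}
  have hS : IsOpen S := isOpen_iff_mem_nhds.2 fun z hz => eventually_eventually_nhds.2 hz
  -- `S` is open by definition. It is closed in the connected domain because at a limit point all
  -- powers of `g` have derivative `id` by continuity, and the preceding lemma applies.
  have key : c.dom ⊆ S := by
    refine c.isConnected_dom.isPreconnected.subset_of_closure_inter_subset hS ⟨w, hw, h⟩ ?_
    rintro z ⟨hzS, hz⟩
    have hfr : ∃ᶠ y in 𝓝 z, y ∈ S ∧ y ∈ c.dom :=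
      (mem_closure_iff_frequently.1 hzS).and_eventually (c.dom_mem_nhds hz)
    refine c.act_eventuallyEq_id_of_fderiv hz ?_ fun k => ?_
    · exact eq_of_frequently_eq_of_tendsto (c.contDiffAt_act g hz).continuousAt tendsto_id
        (hfr.mono fun y hy => hy.1.self_of_nhds)
    · have hc : ContinuousAt (fderiv ℝ (c.act (g ^ k))) z :=
        ((c.contDiffAt_act _ hz).fderiv_right (m := 0) (by simp)).continuousAt
      refine isClosed_singleton.mem_of_frequently_of_tendsto (hfr.mono fun y hy => ?_) hc
      rw [mem_singleton_iff, (c.act_pow_eventuallyEq hy.2 hy.1 k).fderiv_eq, fderiv_id]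
  exact c.act_effective g fun z hz => (key hz).self_of_nhds

/-- The isotropy group of `w` is trivial. -/
def IsFree (w : E) : Prop := ∀ g : c.Grp, c.act g w = w → g = 1

theorem IsFree.eventually {c : OrbifoldChart E X} {w : E} (hw : w ∈ c.dom) (h : c.IsFree w) :
    ∀ᶠ z in 𝓝 w, c.IsFree z := by
  refine eventually_all.2 fun g => ?_
  by_cases hg : g = 1
  · exact Eventually.of_forall fun _ _ => hg
  · have h1 : c.act g w ≠ w := fun h' => hg (h g h')
    filter_upwards [eventually_ne_of_tendsto (c.contDiffAt_act g hw).continuousAt tendsto_id h1] with z hz h2 using absurd h2 hz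

theorem frequently_isFree {w : E} (hw : w ∈ c.dom) : ∃ᶠ z in 𝓝 w, c.IsFree z := by
  -- Induction over finite sets of group elements: each `g ≠ 1` moves points arbitrarily close to
  -- `w`, and being moved is an open condition.
  have key : ∀ s : Set c.Grp, s.Finite → ∀ w ∈ c.dom,
      ∃ᶠ z in 𝓝 w, z ∈ c.dom ∧ ∀ g ∈ s, c.act g z = z → g = 1 := by
    intro s hs
    induction s, hs using Set.Finite.induction_on with
    | empty =>
      intro w hw
      exact (Eventually.frequently (c.dom_mem_nhds hw)).mono fun z hz => ⟨hz, by simp⟩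
    | @insert g s _ hs ih =>
      intro w hw
      by_cases hg : g = 1
      · refine (ih w hw).mono fun z hz => ⟨hz.1, ?_⟩
        rintro k (rfl | hk) h
        exacts [hg, hz.2 k hk h]
      · rw [← frequently_frequently_nhds]
        have h1 : ∃ᶠ z in 𝓝 w, z ∈ c.dom ∧ c.act g z ≠ z := by
          intro h
          refine hg (c.eq_one_of_act_eventuallyEq hw ?_)
          filter_upwards [h, c.dom_mem_nhds hw] with z h1 h2
          by_contra h3
          exact h1 ⟨h2, h3⟩
        refine h1.mono fun z hz => ?_
        have h2 : ∀ᶠ y in 𝓝 z, c.act g y ≠ y :=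
          eventually_ne_of_tendsto (c.contDiffAt_act g hz.1).continuousAt tendsto_id hz.2
        refine ((ih z hz.1).and_eventually h2).mono fun y hy => ⟨hy.1.1, ?_⟩
        rintro k (rfl | hk) h
        exacts [absurd h hy.2, hy.1.2 k hk h]
  exact (key univ finite_univ w hw).mono fun z hz g => hz.2 g (mem_univ g)

/-- Points with equal image differ by some `g`; as the group is finite, near a free point only `g =
1` can relate two nearby points. -/
theorem IsFree.locInjAt {c : OrbifoldChart E X} {w : E} (hw : w ∈ c.dom) (h : c.IsFree w) :
    LocInjAt c.proj w := by
  have h1 : ∀ᶠ q : E × E in 𝓝 (w, w), ∀ g : c.Grp, c.act g q.1 = q.2 → g = 1 := by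
    refine eventually_all.2 fun g => ?_
    by_cases hg : g = 1
    · exact Eventually.of_forall fun _ _ => hg
    · have hne : c.act g w ≠ w := fun h' => hg (h g h')
      have hca : Tendsto (fun q : E × E => c.act g q.1) (𝓝 (w, w)) (𝓝 (c.act g w)) :=
        (c.contDiffAt_act g hw).continuousAt.tendsto.comp (continuous_fst.tendsto (w, w))
      have hcb : Tendsto (fun q : E × E => q.2) (𝓝 (w, w)) (𝓝 w) := continuous_snd.tendsto (w, w)
      filter_upwards [eventually_ne_of_tendsto hca hcb hne] with q hq h2 using absurd h2 hq
  have h2 : ∀ᶠ q : E × E in 𝓝 (w, w), q.1 ∈ c.dom ∧ q.2 ∈ c.dom :=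
    prod_mem_nhds (c.dom_mem_nhds hw) (c.dom_mem_nhds hw)
  filter_upwards [h1, h2] with q hq1 hq2 hq
  obtain ⟨g, hg⟩ := (c.proj_eq_iff _ hq2.1 _ hq2.2).1 hq
  obtain rfl := hq1 g hg
  rw [← hg, c.act_one _ hq2.1]

end OrbifoldChart

namespace IsLocalLift

variable {c : OrbifoldChart E X} {c' : OrbifoldChart E Y} {f : X → Y} {A : Set E} {φ : E → E}

theorem mem_nhds (h : IsLocalLift c c' f A φ) {w : E} (hw : w ∈ A) : A ∈ 𝓝 w :=
  h.isOpen.mem_nhds hw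

theorem contDiffAt (h : IsLocalLift c c' f A φ) {w : E} (hw : w ∈ A) : ContDiffAt ℝ ∞ φ w :=
  h.smooth.contDiffAt (h.mem_nhds hw)

theorem differentiableAt (h : IsLocalLift c c' f A φ) {w : E} (hw : w ∈ A) :
    DifferentiableAt ℝ φ w :=
  (h.contDiffAt hw).differentiableAt (by simp)

theorem continuousAt (h : IsLocalLift c c' f A φ) {w : E} (hw : w ∈ A) : ContinuousAt φ w :=
  (h.contDiffAt hw).continuousAt

theorem continuousAt_map (h : IsLocalLift c c' f A φ) {w : E} (hw : w ∈ A) :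
    ContinuousAt f (c.proj w) := by
  rw [ContinuousAt, ← c.map_proj_nhds (h.subset hw), tendsto_map'_iff, ← h.comm w hw]
  refine ((c'.continuousAt_proj (h.mapsTo hw)).comp (h.continuousAt hw)).tendsto.congr' ?_
  filter_upwards [h.mem_nhds hw] with z hz using h.comm z hz

theorem comp {Z : Type*} [TopologicalSpace Z] {c'' : OrbifoldChart E Z} {k : Y → Z} {B : Set E}
    {ψ : E → E} (hk : IsLocalLift c' c'' k B ψ) (h : IsLocalLift c c' f A φ) :
    IsLocalLift c c'' (k ∘ f) (A ∩ φ ⁻¹' B) (ψ ∘ φ) where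
  isOpen := h.smooth.continuousOn.isOpen_inter_preimage h.isOpen hk.isOpen
  subset := fun _ hw => h.subset hw.1
  mapsTo := fun _ hw => hk.mapsTo hw.2
  smooth := hk.smooth.comp (h.smooth.mono inter_subset_left) (fun _ hw => hw.2)
  comm := fun w hw => by
    simp only [Function.comp_apply]
    rw [hk.comm _ hw.2, h.comm _ hw.1]

end IsLocalLift

/-- A lift of `f` which is a diffeomorphism between open sets and maps `v` to `v'`. -/
structure IsDiffeoLift (c : OrbifoldChart E X) (c' : OrbifoldChart E Y) (f : X → Y)
    (v v' : E) (φ : OpenPartialHomeomorph E E) : Prop where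
  mem_source : v ∈ φ.source
  map_eq : φ v = v'
  lift : IsLocalLift c c' f φ.source φ
  smooth_symm : ContDiffOn ℝ ∞ φ.symm φ.target

namespace IsDiffeoLift

variable {c : OrbifoldChart E X} {c' : OrbifoldChart E Y} {f : X → Y} {v v' : E}
  {φ : OpenPartialHomeomorph E E}

theorem mem_target (h : IsDiffeoLift c c' f v v' φ) : v' ∈ φ.target :=
  h.map_eq ▸ φ.map_source h.mem_source

theorem symm_eq (h : IsDiffeoLift c c' f v v' φ) : φ.symm v' = v := by
  rw [← h.map_eq, φ.left_inv h.mem_source]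

theorem comm_symm (h : IsDiffeoLift c c' f v v' φ) {z : E} (hz : z ∈ φ.target) :
    f (c.proj (φ.symm z)) = c'.proj z := by
  rw [← h.lift.comm _ (φ.map_target hz), φ.right_inv hz]

theorem contDiffAt_symm (h : IsDiffeoLift c c' f v v' φ) {z : E} (hz : z ∈ φ.target) :
    ContDiffAt ℝ ∞ φ.symm z :=
  h.smooth_symm.contDiffAt (φ.open_target.mem_nhds hz)

theorem map_nhds (h : IsDiffeoLift c c' f v v' φ) : map φ (𝓝 v) = 𝓝 v' := by
  rw [φ.map_nhds_eq h.mem_source, h.map_eq]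

theorem trans {Z : Type*} [TopologicalSpace Z] {c'' : OrbifoldChart E Z} {k : Y → Z} {v'' : E}
    {ψ : OpenPartialHomeomorph E E}
    (h : IsDiffeoLift c c' f v v' φ) (hk : IsDiffeoLift c' c'' k v' v'' ψ) :
    IsDiffeoLift c c'' (k ∘ f) v v'' (φ.trans ψ) where
  mem_source := by
    rw [OpenPartialHomeomorph.trans_source]
    exact ⟨h.mem_source, by simpa [h.map_eq] using hk.mem_source⟩
  map_eq := by simp [h.map_eq, hk.map_eq]
  lift := by
    rw [OpenPartialHomeomorph.trans_source]
    exact hk.lift.comp h.lift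
  smooth_symm := by
    rw [OpenPartialHomeomorph.trans_target]
    exact h.smooth_symm.comp (hk.smooth_symm.mono inter_subset_left) fun _ hz => hz.2

theorem symm_id {c' : OrbifoldChart E X} (h : IsDiffeoLift c c' id v v' φ) :
    IsDiffeoLift c' c id v' v φ.symm where
  mem_source := h.mem_target
  map_eq := h.symm_eq
  lift :=
    { isOpen := φ.open_target
      subset := fun z hz => by
        have := h.lift.mapsTo (φ.map_target hz)
        rwa [φ.right_inv hz] at this
      mapsTo := fun z hz => h.lift.subset (φ.map_target hz)
      smooth := h.smooth_symm
      comm := fun z hz => h.comm_symm hz }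
  smooth_symm := h.lift.smooth

/-- Follows from `c'.proj ∘ φ = f ∘ c.proj`. It serves with `f = id` to change charts and with `f =
p` for coverings. -/
theorem locInjAt (h : IsDiffeoLift c c' f v v' φ) (h' : LocInjAt c'.proj v') :
    ∀ᶠ q : E × E in 𝓝 (v, v), f (c.proj q.1) = f (c.proj q.2) → q.1 = q.2 := by
  have hφ : Tendsto φ (𝓝 v) (𝓝 v') := h.map_nhds.le
  have h1 : Tendsto (fun q : E × E => (φ q.1, φ q.2)) (𝓝 (v, v)) (𝓝 (v', v')) := by
    rw [nhds_prod_eq]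
    exact ((hφ.comp tendsto_fst).prodMk_nhds (hφ.comp tendsto_snd))
  have h2 : ∀ᶠ q : E × E in 𝓝 (v, v), q.1 ∈ φ.source ∧ q.2 ∈ φ.source :=
    prod_mem_nhds (φ.open_source.mem_nhds h.mem_source) (φ.open_source.mem_nhds h.mem_source)
  filter_upwards [h1.eventually h', h2] with q hq hs hf
  rw [← h.lift.comm _ hs.1, ← h.lift.comm _ hs.2] at hf
  exact φ.injOn hs.1 hs.2 (hq hf)

end IsDiffeoLift

theorem ChartCompatible.exists_diffeoLift {c c' : OrbifoldChart E X} (h : ChartCompatible c c')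
    {v v' : E} (hv : v ∈ c.dom) (hv' : v' ∈ c'.dom) (he : c.proj v = c'.proj v') :
    ∃ φ, IsDiffeoLift c c' id v v' φ := by
  obtain ⟨φ, h1, h2, h3, h4⟩ := h v hv v' hv' he
  exact ⟨φ, h1, h2, h3, h4⟩

section Regular

variable [Orbifold E X]

theorem mem_maximalAtlas {c : OrbifoldChart E X} (hc : c ∈ Orbifold.atlas (E := E) (X := X)) :
    c ∈ maximalAtlas E X := fun c' hc' => Orbifold.compatible c hc c' hc'

variable (E) in
theorem exists_chart_eq (x : X) :
    ∃ c ∈ Orbifold.atlas (E := E) (X := X), ∃ w ∈ c.dom, c.proj w = x := by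
  obtain ⟨c, hc, w, hw, h⟩ := Orbifold.exists_chart (E := E) x
  exact ⟨c, hc, w, hw, h⟩

theorem IsRegularPoint.locInjAt {c : OrbifoldChart E X} (hc : c ∈ maximalAtlas E X) {w : E}
    (hw : w ∈ c.dom) (h : IsRegularPoint E (c.proj w)) : LocInjAt c.proj w := by
  obtain ⟨c', hc', w', hw', he, hfree⟩ := h
  obtain ⟨φ, hφ⟩ := (hc c' hc').exists_diffeoLift hw hw' he.symm
  exact hφ.locInjAt (OrbifoldChart.IsFree.locInjAt hw' hfree)

variable (E) in
theorem eventually_isRegularPoint {x : X} (h : IsRegularPoint E x) :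
    ∀ᶠ y in 𝓝 x, IsRegularPoint E y := by
  obtain ⟨c, hc, w, hw, rfl, hfree⟩ := h
  rw [← c.map_proj_nhds hw, eventually_map]
  filter_upwards [OrbifoldChart.IsFree.eventually hw hfree, c.dom_mem_nhds hw] with z h1 h2
  exact ⟨c, hc, z, h2, rfl, h1⟩

variable (E) in
theorem frequently_isRegularPoint (x : X) : ∃ᶠ y in 𝓝 x, IsRegularPoint E y := by
  obtain ⟨c, hc, w, hw, rfl⟩ := exists_chart_eq E x
  rw [← c.map_proj_nhds hw, frequently_map]
  refine ((c.frequently_isFree hw).and_eventually (c.dom_mem_nhds hw)).mono fun z hz => ?_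
  exact ⟨c, hc, z, hz.2, rfl, hz.1⟩

variable (E) in
-- Regular points form an open dense set, and the preimage of a dense set under an open map is
-- dense.
theorem frequently_isRegularPoint_and {Y : Type*} [TopologicalSpace Y] [Orbifold E Y] {f : X → Y}
    (hf : IsOpenMap f) (hfc : Continuous f) (x : X) :
    ∃ᶠ y in 𝓝 x, IsRegularPoint E y ∧ IsRegularPoint E (f y) := by
  rw [← frequently_frequently_nhds]
  refine (frequently_isRegularPoint E x).mono fun y hy => ?_
  have h1 : ∃ᶠ z in 𝓝 y, IsRegularPoint E (f z) := by
    have := frequently_isRegularPoint E (f y)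
    rwa [← hf.map_nhds_eq hfc.continuousAt, frequently_map] at this
  exact (h1.and_eventually (eventually_isRegularPoint E hy)).mono fun z hz => ⟨hz.2, hz.1⟩

theorem OrbifoldSmooth.continuous [Orbifold E Y] {f : X → Y} (hf : OrbifoldSmooth E f) :
    Continuous f := by
  refine continuous_iff_continuousAt.2 fun x => ?_
  obtain ⟨c, hc, w, hw, rfl⟩ := exists_chart_eq E x
  obtain ⟨c', hc', w', hw', he⟩ := exists_chart_eq E (f (c.proj w))
  obtain ⟨A, φ, hwA, -, hL⟩ := hf c hc c' hc' w hw w' hw' he.symm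
  exact hL.continuousAt_map hwA

end Regular

end Charts

/-! ### Coverings lift to local diffeomorphisms of charts. -/

section CoveringLifts

variable {E : Type*} [NormedAddCommGroup E] [NormedSpace ℝ E]
  {N : Type*} [TopologicalSpace N] [Orbifold E N]
  {X : Type*} [TopologicalSpace X] [Orbifold E X] {p : N → X}

/-- An inclusion of chart domains covering `p` is a lift of `p`. -/
theorem isDiffeoLift_ofSet {d : OrbifoldChart E N} {c : OrbifoldChart E X} (hdom : d.dom = c.dom)
    (hp : ∀ w ∈ d.dom, p (d.proj w) = c.proj w) {w : E} (hw : w ∈ d.dom) :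
    IsDiffeoLift d c p w w (OpenPartialHomeomorph.ofSet d.dom d.isOpen_dom) where
  mem_source := hw
  map_eq := rfl
  lift :=
    { isOpen := d.isOpen_dom
      subset := Subset.rfl
      mapsTo := fun _ hz => hdom ▸ hz
      smooth := contDiff_id.contDiffOn
      comm := fun z hz => (hp z hz).symm }
  smooth_symm := contDiff_id.contDiffOn

theorem IsDiffeoLift.map_nhds_proj {Y : Type*} [TopologicalSpace Y] {c : OrbifoldChart E N}
    {c' : OrbifoldChart E Y} {f : N → Y}
    {v v' : E} {φ : OpenPartialHomeomorph E E} (h : IsDiffeoLift c c' f v v' φ) :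
    map f (𝓝 (c.proj v)) = 𝓝 (c'.proj v') := by
  have hv := h.lift.subset h.mem_source
  have hv' : v' ∈ c'.dom := h.map_eq ▸ h.lift.mapsTo h.mem_source
  rw [← c.map_proj_nhds hv, ← c'.map_proj_nhds hv', ← h.map_nhds, map_map, map_map]
  refine map_congr ?_
  filter_upwards [h.lift.mem_nhds h.mem_source] with z hz using (h.lift.comm z hz).symm

namespace IsOrbifoldCovering

theorem exists_chart_at (hp : IsOrbifoldCovering E p) (x : X) :
    ∃ c ∈ maximalAtlas E X, x ∈ c.image ∧ ∀ y, p y ∈ c.image → ∃ d ∈ maximalAtlas E N,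
      d.dom = c.dom ∧ y ∈ d.image ∧ ∀ w ∈ d.dom, p (d.proj w) = c.proj w := by
  obtain ⟨c, hc, hx, h⟩ := hp x
  refine ⟨c, hc, hx, fun y hy => ?_⟩
  obtain ⟨d, hd, hdom, himg, -, hproj⟩ := h y hy
  exact ⟨d, hd, hdom, himg ▸ mem_connectedComponentIn hy, hproj⟩

/-- In the special charts of a covering, `p` lifts to the identity of a common domain; chart changes
on both sides bring it to the given charts and points. -/
theorem exists_diffeoLift (hp : IsOrbifoldCovering E p) {c : OrbifoldChart E N}
    (hc : c ∈ Orbifold.atlas (E := E) (X := N)) {c' : OrbifoldChart E X}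
    (hc' : c' ∈ Orbifold.atlas (E := E) (X := X)) {v v' : E} (hv : v ∈ c.dom) (hv' : v' ∈ c'.dom)
    (h : p (c.proj v) = c'.proj v') : ∃ φ, IsDiffeoLift c c' p v v' φ := by
  obtain ⟨e, he, hx, hd⟩ := hp.exists_chart_at (p (c.proj v))
  obtain ⟨d, hd, hdom, ⟨w, hw, hwv⟩, hproj⟩ := hd _ hx
  have hwe : e.proj w = c'.proj v' := by rw [← hproj w hw, hwv, h]
  obtain ⟨φ, hφ⟩ := (hd c hc).exists_diffeoLift hw hv hwv
  obtain ⟨ψ, hψ⟩ := (he c' hc').exists_diffeoLift (hdom ▸ hw) hv' hwe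
  exact ⟨_, (hφ.symm_id.trans (isDiffeoLift_ofSet hdom hproj hw)).trans hψ⟩

theorem exists_diffeoLift_at (hp : IsOrbifoldCovering E p) (x : N) :
    ∃ c ∈ Orbifold.atlas (E := E) (X := N), ∃ c' ∈ Orbifold.atlas (E := E) (X := X),
      ∃ v v' φ, c.proj v = x ∧ IsDiffeoLift c c' p v v' φ := by
  obtain ⟨c, hc, v, hv, rfl⟩ := exists_chart_eq E x
  obtain ⟨c', hc', v', hv', he⟩ := exists_chart_eq E (p (c.proj v))
  obtain ⟨φ, hφ⟩ := hp.exists_diffeoLift hc hc' hv hv' he.symm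
  exact ⟨c, hc, c', hc', v, v', φ, rfl, hφ⟩

theorem smooth (hp : IsOrbifoldCovering E p) : OrbifoldSmooth E p := by
  intro c hc c' hc' v hv v' hv' h
  obtain ⟨φ, hφ⟩ := hp.exists_diffeoLift hc hc' hv hv' h
  exact ⟨φ.source, φ, hφ.mem_source, hφ.map_eq, hφ.lift⟩

theorem isOpenMap (hp : IsOrbifoldCovering E p) : IsOpenMap p := by
  refine IsOpenMap.of_nhds_le fun x => ?_
  obtain ⟨c, hc, c', hc', v, v', φ, rfl, hφ⟩ := hp.exists_diffeoLift_at x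
  rw [hφ.map_nhds_proj, ← hφ.lift.comm _ hφ.mem_source, hφ.map_eq]

/-- The range is open, and it is closed because it contains every special chart image that it meets.
-/
theorem surjective [PreconnectedSpace X] [Nonempty N] (hp : IsOrbifoldCovering E p) :
    Function.Surjective p := by
  rw [← range_eq_univ]
  refine IsClopen.eq_univ ⟨⟨isOpen_iff_mem_nhds.2 fun x hx => ?_⟩, hp.isOpenMap.isOpen_range⟩
    (range_nonempty p)
  obtain ⟨c, hc, hxc, h⟩ := hp.exists_chart_at x
  refine mem_of_superset (c.isOpen_image.mem_nhds hxc) ?_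
  rintro _ hz ⟨y, rfl⟩
  obtain ⟨d, hd, hdom, -, hproj⟩ := h y hz
  obtain ⟨w, hw, rfl⟩ := hxc
  exact hx ⟨d.proj w, hproj w (hdom ▸ hw)⟩

/-- Over a regular point there is no branching: in charts `p` is a diffeomorphism followed by a
locally injective projection. -/
theorem locInjAt (hp : IsOrbifoldCovering E p) {x : N} (hx : IsRegularPoint E (p x)) :
    LocInjAt p x := by
  obtain ⟨c, hc, c', hc', v, v', φ, rfl, hφ⟩ := hp.exists_diffeoLift_at x
  have hv := hφ.lift.subset hφ.mem_source
  have hv' : v' ∈ c'.dom := hφ.map_eq ▸ hφ.lift.mapsTo hφ.mem_source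
  rw [← hφ.lift.comm _ hφ.mem_source, hφ.map_eq] at hx
  have h1 := hφ.locInjAt (hx.locInjAt (mem_maximalAtlas hc') hv')
  rw [LocInjAt, nhds_prod_eq, ← c.map_proj_nhds hv, prod_map_map_eq, eventually_map,
    ← nhds_prod_eq]
  filter_upwards [h1] with q hq h using congrArg c.proj (hq h)

end IsOrbifoldCovering

end CoveringLifts

/-! ### `Ad`-invariant functionals kill brackets: the local computation. -/

section LocalProduct

variable {V : Type*} [NormedAddCommGroup V] [NormedSpace ℝ V]

/-- Let `P` be a local product with identity `e`, with left-invariant fields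
`x ↦ DP (x, e) (0, v)`, and let `h` be a functional invariant under the
adjoint action. Then `h` vanishes on brackets of left-invariant fields at `e`. -/
theorem map_lieBracket_eq_zero_of_ad_invariant [CompleteSpace V] {P : V × V → V} {e : V}
    (hP : ContDiffAt ℝ 2 P (e, e)) (hl : ∀ᶠ x in 𝓝 e, P (e, x) = x)
    (hr : ∀ᶠ x in 𝓝 e, P (x, e) = x) (h : V →L[ℝ] ℝ)
    (had : ∀ᶠ x in 𝓝 e, ∀ w, ∃ w', h w' = h w ∧
      fderiv ℝ P (e, x) (w', 0) = fderiv ℝ P (x, e) (0, w)) (v w : V) :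
    h (VectorField.lieBracket ℝ (fun x => fderiv ℝ P (x, e) (0, v))
      (fun x => fderiv ℝ P (x, e) (0, w)) e) = 0 := by
  set inl := ContinuousLinearMap.inl ℝ V V
  set inr := ContinuousLinearMap.inr ℝ V V
  set D := fderiv ℝ P with hD
  have hDd : DifferentiableAt ℝ D (e, e) :=
    (hP.fderiv_right (m := 1) (by norm_num)).differentiableAt (by simp)
  set D2 := fderiv ℝ D (e, e) with hD2
  have hPd : DifferentiableAt ℝ P (e, e) := hP.differentiableAt (by simp)
  have hix : HasFDerivAt (fun x : V => (x, e)) inl e := hasFDerivAt_prodMk_left e e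
  have hiy : HasFDerivAt (fun x : V => (e, x)) inr e := hasFDerivAt_prodMk_right e e
  have hsym : ∀ a b, D2 a b = D2 b a := fun a b =>
    (hP.isSymmSndFDerivAt (by simp)) a b
  -- first derivatives at the identity
  have hone_l : D (e, e) ∘L inl = ContinuousLinearMap.id ℝ V := by
    have h1 : HasFDerivAt (fun x => P (x, e)) (D (e, e) ∘L inl) e :=
      HasFDerivAt.comp e (f := fun x : V => (x, e)) hPd.hasFDerivAt hix
    exact h1.unique ((hasFDerivAt_id e).congr_of_eventuallyEq hr)
  have hone_r : D (e, e) ∘L inr = ContinuousLinearMap.id ℝ V := by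
    have h1 : HasFDerivAt (fun x => P (e, x)) (D (e, e) ∘L inr) e :=
      HasFDerivAt.comp e (f := fun x : V => (e, x)) hPd.hasFDerivAt hiy
    exact h1.unique ((hasFDerivAt_id e).congr_of_eventuallyEq hl)
  have hDx : HasFDerivAt (fun x => D (x, e)) (D2 ∘L inl) e :=
    HasFDerivAt.comp e (f := fun x : V => (x, e)) hDd.hasFDerivAt hix
  have hDy : HasFDerivAt (fun x => D (e, x)) (D2 ∘L inr) e :=
    HasFDerivAt.comp e (f := fun x : V => (e, x)) hDd.hasFDerivAt hiy
  -- `A x` and `B x` are the derivatives at `e` of right and left translation by `x`.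
  set A : V → V →L[ℝ] V := fun x => D (e, x) ∘L inl with hA
  set B : V → V →L[ℝ] V := fun x => D (x, e) ∘L inr with hB
  have hAd : HasFDerivAt A (((ContinuousLinearMap.compL ℝ V (V × V) V).flip inl) ∘L (D2 ∘L inr)) e :=
    ((ContinuousLinearMap.compL ℝ V (V × V) V).flip inl).hasFDerivAt.comp e hDy
  have hBd : HasFDerivAt B (((ContinuousLinearMap.compL ℝ V (V × V) V).flip inr) ∘L (D2 ∘L inl)) e :=
    ((ContinuousLinearMap.compL ℝ V (V × V) V).flip inr).hasFDerivAt.comp e hDx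
  have hAe : A e = 1 := hone_l
  have hBe : B e = 1 := hone_r
  -- the right-invariant extension of `h`
  set α : V → V →L[ℝ] ℝ := fun x => h ∘L Ring.inverse (A x) with hα
  have hinvd : DifferentiableAt ℝ (fun x => Ring.inverse (A x)) e := by
    have h1 : DifferentiableAt ℝ (Ring.inverse : (V →L[ℝ] V) → _) (A e) := by
      rw [hAe]
      exact (contDiffAt_ringInverse ℝ (1 : (V →L[ℝ] V)ˣ)).differentiableAt (n := 1) (by simp)
    exact h1.comp e hAd.differentiableAt
  have hαd : DifferentiableAt ℝ α e :=
    (ContinuousLinearMap.compL ℝ V V ℝ h).differentiableAt.comp e hinvd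
  have hαe : α e = h := by simp [hα, hAe, Ring.inverse_one]; rfl
  have hunit : ∀ᶠ x in 𝓝 e, IsUnit (A x) := by
    refine hAd.continuousAt.eventually_mem (Units.isOpen.mem_nhds ?_)
    exact hAe ▸ isUnit_one
  have hαA : ∀ᶠ x in 𝓝 e, ∀ w, α x (A x w) = h w := by
    filter_upwards [hunit] with x hx w
    have := congrArg (fun T : V →L[ℝ] V => h (T w)) (Ring.inverse_mul_cancel (A x) hx)
    simpa [hα] using this
  -- Invariance of `h` makes the right-invariant form `α` left-invariant as well.
  have hαB : ∀ᶠ x in 𝓝 e, ∀ w, α x (B x w) = h w := by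
    filter_upwards [hαA, had] with x hx hw w
    obtain ⟨w', h1, h2⟩ := hw w
    have : B x w = A x w' := by simpa [hA, hB, inl, inr] using h2.symm
    rw [this, hx, h1]
  have key : ∀ {C : V → V →L[ℝ] V} {C' : V →L[ℝ] V →L[ℝ] V}, HasFDerivAt C C' e → C e = 1 →
      (∀ᶠ x in 𝓝 e, ∀ w, α x (C x w) = h w) → ∀ v w, fderiv ℝ α e v w + h (C' v w) = 0 := by
    intro C C' hC hCe hαC v w
    have h1 : HasFDerivAt (fun x => C x w) (C'.flip w) e := by
      simpa using hC.clm_apply (hasFDerivAt_const w e)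
    have h2 := hαd.hasFDerivAt.clm_apply h1
    have h3 : HasFDerivAt (fun x => α x (C x w)) (0 : V →L[ℝ] ℝ) e :=
      (hasFDerivAt_const (h w) e).congr_of_eventuallyEq (hαC.mono fun x hx => hx w)
    have h4 := congrArg (fun T : V →L[ℝ] ℝ => T v) (h2.unique h3)
    simp only [hCe, hαe] at h4
    simpa [add_comm] using h4
  -- Subtracting the two identities eliminates the derivative of `α` and leaves `h (D2 (0, v) (w,
  -- 0)) = h (D2 (v, 0) (0, w))`. By symmetry of `D2` this is the vanishing of `h` on the bracket.
  have k1 := key hAd hAe hαA v w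
  have k2 := key hBd hBe hαB v w
  have hf : ∀ u : V, HasFDerivAt (fun x => D (x, e) (0, u)) ((D2 ∘L inl).flip (0, u)) e := by
    intro u
    simpa using hDx.clm_apply (hasFDerivAt_const ((0 : V), u) e)
  have hval : ∀ u : V, D (e, e) (0, u) = u := fun u => by
    simpa [inr] using congrArg (fun T : V →L[ℝ] V => T u) hone_r
  rw [VectorField.lieBracket, (hf v).fderiv, (hf w).fderiv, hval, hval]
  simp only [ContinuousLinearMap.flip_apply, ContinuousLinearMap.comp_apply,
    ContinuousLinearMap.compL_apply, inl, inr, ContinuousLinearMap.inl_apply,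
    ContinuousLinearMap.inr_apply] at k1 k2 ⊢
  rw [map_sub, hsym (w, 0) (0, v)]
  linarith

end LocalProduct

/-! ### Lie algebras with trivial radical are perfect. -/

section Perfect

/-- A semisimple Lie algebra is perfect. -/
theorem lie_top_top_eq_top {K L : Type*} [Field K] [CharZero K] [LieRing L] [LieAlgebra K L]
    [FiniteDimensional K L] [LieAlgebra.HasTrivialRadical K L] :
    ⁅(⊤ : LieIdeal K L), (⊤ : LieIdeal K L)⁆ = ⊤ := by
  -- A complementary ideal `J` is abelian, since `⁅J, J⁆` lies in both summands; hence it is zero.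
  obtain ⟨J, hJ⟩ := exists_isCompl ⁅(⊤ : LieIdeal K L), (⊤ : LieIdeal K L)⁆
  have hab : IsLieAbelian J := by
    rw [LieSubmodule.lie_abelian_iff_lie_self_eq_bot, eq_bot_iff, ← hJ.inf_eq_bot]
    exact le_inf (LieSubmodule.mono_lie le_top le_top) (LieSubmodule.lie_le_right J J)
  have hJ0 : J = ⊥ := (LieAlgebra.hasTrivialRadical_iff_no_abelian_ideals K L).1 inferInstance J hab
  simpa [hJ0] using hJ.sup_eq_top

end Perfect

/-! ### The Lie bracket and `Ad` in the chart at the identity. -/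

section LieGroup

variable {EG : Type*} [NormedAddCommGroup EG] [NormedSpace ℝ EG]
  {G : Type*} [TopologicalSpace G] [ChartedSpace EG G] [Group G] [LieGroup 𝓘(ℝ, EG) ∞ G]

variable (EG) in
/-- The multiplication of `G` in the preferred chart at `1`. -/
noncomputable def chartMul (G : Type*) [TopologicalSpace G] [ChartedSpace EG G] [Group G] (q : EG × EG) : EG :=
  extChartAt 𝓘(ℝ, EG) (1 : G) ((extChartAt 𝓘(ℝ, EG) (1 : G)).symm q.1 *
    (extChartAt 𝓘(ℝ, EG) (1 : G)).symm q.2)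

theorem contMDiffAt_chart_symm {x : EG} (hx : x ∈ (extChartAt 𝓘(ℝ, EG) (1 : G)).target) :
    ContMDiffAt 𝓘(ℝ, EG) 𝓘(ℝ, EG) ∞ (extChartAt 𝓘(ℝ, EG) (1 : G)).symm x := by
  have : IsManifold 𝓘(ℝ, EG) ∞ G := inferInstance
  exact (contMDiffOn_extChartAt_symm (n := ∞) (1 : G)).contMDiffAt
    ((isOpen_extChartAt_target (1 : G)).mem_nhds hx)

theorem contMDiffAt_chart {g : G} (hg : g ∈ (extChartAt 𝓘(ℝ, EG) (1 : G)).source) :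
    ContMDiffAt 𝓘(ℝ, EG) 𝓘(ℝ, EG) ∞ (extChartAt 𝓘(ℝ, EG) (1 : G)) g := by
  have : IsManifold 𝓘(ℝ, EG) ∞ G := inferInstance
  exact contMDiffAt_extChartAt' (by rwa [extChartAt_source] at hg)

theorem contDiffAt_chartMul {x y : EG} (hx : x ∈ (extChartAt 𝓘(ℝ, EG) (1 : G)).target)
    (hy : y ∈ (extChartAt 𝓘(ℝ, EG) (1 : G)).target)
    (hxy : (extChartAt 𝓘(ℝ, EG) (1 : G)).symm x * (extChartAt 𝓘(ℝ, EG) (1 : G)).symm y ∈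
      (extChartAt 𝓘(ℝ, EG) (1 : G)).source) :
    ContDiffAt ℝ ∞ (chartMul EG G) (x, y) := by
  rw [← contMDiffAt_iff_contDiffAt]
  have h1 : ContMDiffAt 𝓘(ℝ, EG × EG) 𝓘(ℝ, EG) ∞
      (fun q : EG × EG => (extChartAt 𝓘(ℝ, EG) (1 : G)).symm q.1) (x, y) :=
    ContMDiffAt.comp (x, y) (contMDiffAt_chart_symm hx) contDiff_fst.contDiffAt.contMDiffAt
  have h2 : ContMDiffAt 𝓘(ℝ, EG × EG) 𝓘(ℝ, EG) ∞
      (fun q : EG × EG => (extChartAt 𝓘(ℝ, EG) (1 : G)).symm q.2) (x, y) :=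
    ContMDiffAt.comp (x, y) (contMDiffAt_chart_symm hy) contDiff_snd.contDiffAt.contMDiffAt
  exact ContMDiffAt.comp (x, y) (contMDiffAt_chart hxy) (h1.mul h2)

theorem mfderiv_eq_fderiv_chart {F : Type*} [NormedAddCommGroup F] [NormedSpace ℝ F] {f : G → F}
    (hf : MDifferentiableAt 𝓘(ℝ, EG) 𝓘(ℝ, F) f 1) (v : EG) :
    mfderiv 𝓘(ℝ, EG) 𝓘(ℝ, F) f 1 v = fderiv ℝ (f ∘ (extChartAt 𝓘(ℝ, EG) (1 : G)).symm)
      (extChartAt 𝓘(ℝ, EG) (1 : G) 1) v := by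
  have h1 : mfderiv 𝓘(ℝ, EG) 𝓘(ℝ, F) f 1 = fderivWithin ℝ (writtenInExtChartAt 𝓘(ℝ, EG) 𝓘(ℝ, F)
      (1 : G) f) (range 𝓘(ℝ, EG)) (extChartAt 𝓘(ℝ, EG) (1 : G) 1) := if_pos hf
  rw [modelWithCornersSelf_coe, range_id, fderivWithin_univ] at h1
  exact congrArg (fun T : EG →L[ℝ] F => T v) h1

variable (EG) in
theorem mdifferentiableAt_mul_left (g k : G) :
    MDifferentiableAt 𝓘(ℝ, EG) 𝓘(ℝ, EG) (fun k : G => g * k) k :=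
  (contMDiff_mul_left (I := 𝓘(ℝ, EG)) (n := ∞) (a := g)).mdifferentiable (by simp) k

variable (EG) in
theorem mdifferentiableAt_mul_right (g k : G) :
    MDifferentiableAt 𝓘(ℝ, EG) 𝓘(ℝ, EG) (fun k : G => k * g) k :=
  (contMDiff_mul_right (I := 𝓘(ℝ, EG)) (n := ∞) (a := g)).mdifferentiable (by simp) k

variable (EG) in
theorem mdifferentiableAt_conj (g k : G) :
    MDifferentiableAt 𝓘(ℝ, EG) 𝓘(ℝ, EG) (fun k : G => g * k * g⁻¹) k :=
  (mdifferentiableAt_mul_right EG g⁻¹ (g * k)).comp k (mdifferentiableAt_mul_left EG g k)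

variable (EG) in
theorem Ad_one (ξ : GroupLieAlgebra 𝓘(ℝ, EG) G) : Ad EG (1 : G) ξ = ξ := by
  have h : (fun k : G => 1 * k * 1⁻¹) = id := by ext k; simp
  have h2 : ∀ f : G → G, f = id → (mfderiv 𝓘(ℝ, EG) 𝓘(ℝ, EG) f 1 : EG → EG) ξ = ξ := by
    rintro f rfl
    rw [mfderiv_id]; rfl
  exact h2 _ h

/-- The chain rule for `k ↦ f (g * k * g⁻¹)`. -/
theorem mfderiv_comp_conj {F : Type*} [NormedAddCommGroup F] [NormedSpace ℝ F] {f : G → F}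
    (hf : MDifferentiableAt 𝓘(ℝ, EG) 𝓘(ℝ, F) f 1) (g : G) (ξ : GroupLieAlgebra 𝓘(ℝ, EG) G) :
    (mfderiv 𝓘(ℝ, EG) 𝓘(ℝ, F) (fun k : G => f (g * k * g⁻¹)) 1 : EG → F) ξ =
      (mfderiv 𝓘(ℝ, EG) 𝓘(ℝ, F) f 1 : EG → F) (Ad EG g ξ) :=
  mfderiv_comp_apply_of_eq (x := (1 : G)) (y := (1 : G)) (f := fun k : G => g * k * g⁻¹) hf
    (mdifferentiableAt_conj EG g 1) (by simp) ξ

theorem eventually_mem_chart_target : ∀ᶠ x in 𝓝 (extChartAt 𝓘(ℝ, EG) (1 : G) 1),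
    x ∈ (extChartAt 𝓘(ℝ, EG) (1 : G)).target :=
  (isOpen_extChartAt_target (1 : G)).mem_nhds (mem_extChartAt_target (1 : G))

theorem fderiv_chartMul_right {x : EG} (hx : x ∈ (extChartAt 𝓘(ℝ, EG) (1 : G)).target) (w : EG) :
    fderiv ℝ (chartMul EG G) (x, extChartAt 𝓘(ℝ, EG) (1 : G) 1) (0, w) =
      (mfderiv 𝓘(ℝ, EG) 𝓘(ℝ, EG) (fun k : G => extChartAt 𝓘(ℝ, EG) (1 : G)
        ((extChartAt 𝓘(ℝ, EG) (1 : G)).symm x * k)) 1 : EG → EG) w := by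
  set φ := extChartAt 𝓘(ℝ, EG) (1 : G)
  have hs : φ.symm x ∈ φ.source := φ.map_target hx
  have h1 : MDifferentiableAt 𝓘(ℝ, EG) 𝓘(ℝ, EG) (fun k : G => φ (φ.symm x * k)) 1 := by
    refine MDifferentiableAt.comp (I' := 𝓘(ℝ, EG)) (1 : G) ?_ (mdifferentiableAt_mul_left EG (φ.symm x) 1)
    exact (contMDiffAt_chart (by simpa only [mul_one, one_mul] using hs)).mdifferentiableAt (by simp)
  have h2 : DifferentiableAt ℝ (chartMul EG G) (x, φ 1) :=
    (contDiffAt_chartMul hx (mem_extChartAt_target (1 : G))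
      (by simpa only [φ, extChartAt_to_inv, mul_one, one_mul] using hs)).differentiableAt (by simp)
  have h3 : HasFDerivAt (fun y => chartMul EG G (x, y)) _ (φ 1) :=
    HasFDerivAt.comp (φ 1) (f := fun y : EG => (x, y)) h2.hasFDerivAt (hasFDerivAt_prodMk_right x (φ 1))
  refine Eq.trans ?_ (mfderiv_eq_fderiv_chart h1 w).symm
  have h4 : ((fun k : G => φ (φ.symm x * k)) ∘ φ.symm) = fun y => chartMul EG G (x, y) := rfl
  rw [h4, h3.fderiv]
  simp

theorem fderiv_chartMul_left {x : EG} (hx : x ∈ (extChartAt 𝓘(ℝ, EG) (1 : G)).target) (w : EG) :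
    fderiv ℝ (chartMul EG G) (extChartAt 𝓘(ℝ, EG) (1 : G) 1, x) (w, 0) =
      (mfderiv 𝓘(ℝ, EG) 𝓘(ℝ, EG) (fun k : G => extChartAt 𝓘(ℝ, EG) (1 : G)
        (k * (extChartAt 𝓘(ℝ, EG) (1 : G)).symm x)) 1 : EG → EG) w := by
  set φ := extChartAt 𝓘(ℝ, EG) (1 : G)
  have hs : φ.symm x ∈ φ.source := φ.map_target hx
  have h1 : MDifferentiableAt 𝓘(ℝ, EG) 𝓘(ℝ, EG) (fun k : G => φ (k * φ.symm x)) 1 := by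
    refine MDifferentiableAt.comp (I' := 𝓘(ℝ, EG)) (1 : G) ?_ (mdifferentiableAt_mul_right EG (φ.symm x) 1)
    exact (contMDiffAt_chart (by simpa only [mul_one, one_mul] using hs)).mdifferentiableAt (by simp)
  have h2 : DifferentiableAt ℝ (chartMul EG G) (φ 1, x) :=
    (contDiffAt_chartMul (mem_extChartAt_target (1 : G)) hx
      (by simpa only [φ, extChartAt_to_inv, mul_one, one_mul] using hs)).differentiableAt (by simp)
  have h3 : HasFDerivAt (fun y => chartMul EG G (y, x)) _ (φ 1) :=
    HasFDerivAt.comp (φ 1) (f := fun y : EG => (y, x)) h2.hasFDerivAt (hasFDerivAt_prodMk_left (φ 1) x)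
  refine Eq.trans ?_ (mfderiv_eq_fderiv_chart h1 w).symm
  have h4 : ((fun k : G => φ (k * φ.symm x)) ∘ φ.symm) = fun y => chartMul EG G (y, x) := rfl
  rw [h4, h3.fderiv]
  simp

/-- The adjoint representation relates the derivatives of left and right translations. -/
theorem fderiv_chartMul_Ad {x : EG} (hx : x ∈ (extChartAt 𝓘(ℝ, EG) (1 : G)).target) (w : EG) :
    fderiv ℝ (chartMul EG G) (extChartAt 𝓘(ℝ, EG) (1 : G) 1, x)
        ((Ad EG ((extChartAt 𝓘(ℝ, EG) (1 : G)).symm x) : EG → EG) w, 0) =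
      fderiv ℝ (chartMul EG G) (x, extChartAt 𝓘(ℝ, EG) (1 : G) 1) (0, w) := by
  refine (fderiv_chartMul_left hx _).trans (Eq.trans ?_ (fderiv_chartMul_right hx w).symm)
  set φ := extChartAt 𝓘(ℝ, EG) (1 : G)
  have hs : φ.symm x ∈ φ.source := φ.map_target hx
  have h1 : MDifferentiableAt 𝓘(ℝ, EG) 𝓘(ℝ, EG) (fun k : G => φ (k * φ.symm x)) 1 := by
    refine MDifferentiableAt.comp (I' := 𝓘(ℝ, EG)) (1 : G) ?_ (mdifferentiableAt_mul_right EG (φ.symm x) 1)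
    exact (contMDiffAt_chart (by simpa only [mul_one, one_mul] using hs)).mdifferentiableAt (by simp)
  refine (mfderiv_comp_conj h1 (φ.symm x) w).symm.trans ?_
  have h2 : (fun k : G => φ (φ.symm x * k * (φ.symm x)⁻¹ * φ.symm x)) =
      fun k => φ (φ.symm x * k) := by
    funext k
    rw [inv_mul_cancel_right]
  exact congrArg (fun f : G → EG => (mfderiv 𝓘(ℝ, EG) 𝓘(ℝ, EG) f 1 : EG → EG) w) h2

/-- In the chart at `1`, left-invariant vector fields are given by the derivative of `chartMul`. -/
theorem mpullbackWithin_mulInvariantVectorField {x : EG}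
    (hx : x ∈ (extChartAt 𝓘(ℝ, EG) (1 : G)).target) (v : GroupLieAlgebra 𝓘(ℝ, EG) G) :
    VectorField.mpullbackWithin 𝓘(ℝ, EG) 𝓘(ℝ, EG) (extChartAt 𝓘(ℝ, EG) (1 : G)).symm
      (mulInvariantVectorField v) (range 𝓘(ℝ, EG)) x =
      fderiv ℝ (chartMul EG G) (x, extChartAt 𝓘(ℝ, EG) (1 : G) 1) (0, v) := by
  have : IsManifold 𝓘(ℝ, EG) ∞ G := inferInstance
  have : IsManifold 𝓘(ℝ, EG) 1 G := IsManifold.of_le (n := ∞) (by simp)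
  refine Eq.trans ?_ (fderiv_chartMul_right hx v).symm
  rw [VectorField.mpullbackWithin_apply,
    ContinuousLinearMap.inverse_eq (mfderivWithin_extChartAt_symm_comp_mfderiv_extChartAt hx)
      (mfderiv_extChartAt_comp_mfderivWithin_extChartAt_symm hx)]
  set φ := extChartAt 𝓘(ℝ, EG) (1 : G)
  have hs : φ.symm x ∈ φ.source := φ.map_target hx
  exact (mfderiv_comp_apply_of_eq (x := (1 : G)) (y := φ.symm x) (f := fun k : G => φ.symm x * k)
    ((contMDiffAt_chart hs).mdifferentiableAt (by simp))
    (mdifferentiableAt_mul_left EG (φ.symm x) 1) (by simp) v).symm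

theorem lie_eq_lieBracket_chartMul [CompleteSpace EG] (v w : GroupLieAlgebra 𝓘(ℝ, EG) G) :
    ⁅v, w⁆ = VectorField.lieBracket ℝ
      (fun x => fderiv ℝ (chartMul EG G) (x, extChartAt 𝓘(ℝ, EG) (1 : G) 1) (0, v))
      (fun x => fderiv ℝ (chartMul EG G) (x, extChartAt 𝓘(ℝ, EG) (1 : G) 1) (0, w))
      (extChartAt 𝓘(ℝ, EG) (1 : G) 1) := by
  have : IsManifold 𝓘(ℝ, EG) ∞ G := inferInstance
  have : IsManifold 𝓘(ℝ, EG) 1 G := IsManifold.of_le (n := ∞) (by simp)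
  have hset : ((extChartAt 𝓘(ℝ, EG) (1 : G)).symm ⁻¹' univ ∩ range 𝓘(ℝ, EG)) = univ := by simp
  have hinv : ∀ (T : EG →L[ℝ] EG), T = ContinuousLinearMap.id ℝ EG → ∀ u, T.inverse u = u := by
    rintro T rfl u
    rw [ContinuousLinearMap.inverse_id, ContinuousLinearMap.id_apply]
  rw [GroupLieAlgebra.bracket_def, ← VectorField.mlieBracketWithin_univ,
    VectorField.mlieBracketWithin_apply, hset]
  -- The preferred chart has derivative `id` at its base point, so pulling the bracket back to the
  -- tangent space at `1` changes nothing.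
  refine (hinv _ mfderiv_extChartAt_self _).trans
    ((congrFun VectorField.lieBracketWithin_univ _).trans ?_)
  have hv : ∀ v : GroupLieAlgebra 𝓘(ℝ, EG) G, VectorField.mpullbackWithin 𝓘(ℝ, EG) 𝓘(ℝ, EG) (extChartAt 𝓘(ℝ, EG) (1 : G)).symm
      (mulInvariantVectorField v) (range 𝓘(ℝ, EG)) =ᶠ[𝓝 (extChartAt 𝓘(ℝ, EG) (1 : G) 1)]
      fun x => fderiv ℝ (chartMul EG G) (x, extChartAt 𝓘(ℝ, EG) (1 : G) 1) (0, v) := fun v =>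
    eventually_mem_chart_target.mono fun x hx => mpullbackWithin_mulInvariantVectorField hx v
  exact (hv v).lieBracket_vectorField_eq (hv w)

/-- Functionals that are invariant under the adjoint representation vanish on brackets. -/
theorem map_lie_eq_zero_of_Ad_invariant [FiniteDimensional ℝ EG] [CompleteSpace EG]
    {h : LieDual EG G} (hh : ∀ (g : G) (ξ), h (Ad EG g ξ) = h ξ)
    (v w : GroupLieAlgebra 𝓘(ℝ, EG) G) : h ⁅v, w⁆ = 0 := by
  set φ := extChartAt 𝓘(ℝ, EG) (1 : G) with hφ
  have h1 : φ 1 ∈ φ.target := mem_extChartAt_target (1 : G)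
  have hs1 : φ.symm (φ 1) = 1 := extChartAt_to_inv (1 : G)
  have hP : ContDiffAt ℝ 2 (chartMul EG G) (φ 1, φ 1) :=
    (contDiffAt_chartMul h1 h1 (by
      simp only [← hφ, hs1, mul_one]; exact mem_extChartAt_source (1 : G))).of_le ENat.LEInfty.out
  let h' : EG →ₗ[ℝ] ℝ := h
  have := map_lieBracket_eq_zero_of_ad_invariant hP
    (eventually_mem_chart_target.mono fun x hx => by
      simp only [chartMul, ← hφ, hs1, one_mul]; exact φ.right_inv hx)
    (eventually_mem_chart_target.mono fun x hx => by
      simp only [chartMul, ← hφ, hs1, mul_one]; exact φ.right_inv hx)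
    h'.toContinuousLinearMap
    -- The witness is `Ad (φ.symm x) w`.
    (eventually_mem_chart_target.mono fun x hx w => ⟨_, hh (φ.symm x) w, fderiv_chartMul_Ad hx w⟩) v w
  rw [lie_eq_lieBracket_chartMul]
  exact this

theorem mem_derivedAnnihilator_of_Ad_invariant [FiniteDimensional ℝ EG] [CompleteSpace EG]
    {h : LieDual EG G} (hh : ∀ (g : G) (ξ), h (Ad EG g ξ) = h ξ) :
    h ∈ derivedAnnihilator EG G := by
  rw [Submodule.mem_dualAnnihilator]
  intro x hx
  rw [derivedAlg, LieSubmodule.lieIdeal_oper_eq_linear_span'] at hx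
  refine Submodule.span_induction ?_ (map_zero h) ?_ ?_ hx
  · rintro _ ⟨v, -, w, -, rfl⟩
    exact map_lie_eq_zero_of_Ad_invariant hh v w
  · intro a b _ _ ha hb
    rw [map_add, ha, hb, add_zero]
  · intro c a _ ha
    rw [map_smul, ha, smul_zero]

theorem derivedAlg_eq_top [FiniteDimensional ℝ EG] [CompleteSpace EG]
    [LieAlgebra.HasTrivialRadical ℝ (GroupLieAlgebra 𝓘(ℝ, EG) G)] : derivedAlg EG G = ⊤ := by
  have : FiniteDimensional ℝ (GroupLieAlgebra 𝓘(ℝ, EG) G) := inferInstanceAs (FiniteDimensional ℝ EG)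
  exact lie_top_top_eq_top
end LieGroup

/-! ### Local lifts of actions and infinitesimal generators. -/

section ActionLifts

variable {EG : Type*} [NormedAddCommGroup EG] [NormedSpace ℝ EG]
  {G : Type*} [TopologicalSpace G] [ChartedSpace EG G] [Group G]
  {E : Type*} [NormedAddCommGroup E] [NormedSpace ℝ E]
  {X : Type*} [TopologicalSpace X] [MulAction G X]
  {Y : Type*} [TopologicalSpace Y] [MulAction G Y]

namespace IsActionLift

variable {c c' : OrbifoldChart E X} {W : Set G} {A : Set E} {F : G × E → E}

theorem contMDiffAt (h : IsActionLift EG c c' W A F) {g : G} (hg : g ∈ W) {w : E} (hw : w ∈ A) :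
    ContMDiffAt ((𝓘(ℝ, EG)).prod 𝓘(ℝ, E)) 𝓘(ℝ, E) ∞ F (g, w) :=
  h.smooth.contMDiffAt (prod_mem_nhds (h.isOpen_left.mem_nhds hg) (h.isOpen_right.mem_nhds hw))

theorem contMDiffAt_left (h : IsActionLift EG c c' W A F) {g : G} (hg : g ∈ W) {w : E}
    (hw : w ∈ A) : ContMDiffAt 𝓘(ℝ, EG) 𝓘(ℝ, E) ∞ (fun k => F (k, w)) g :=
  ContMDiffAt.comp g (h.contMDiffAt hg hw) (contMDiffAt_id.prodMk contMDiffAt_const)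

theorem contDiffAt_right (h : IsActionLift EG c c' W A F) {g : G} (hg : g ∈ W) {w : E}
    (hw : w ∈ A) : ContDiffAt ℝ ∞ (fun z => F (g, z)) w := by
  rw [← contMDiffAt_iff_contDiffAt]
  exact ContMDiffAt.comp w (h.contMDiffAt hg hw) (contMDiffAt_const.prodMk contMDiffAt_id)

theorem isLocalLift (h : IsActionLift EG c c' W A F) {g : G} (hg : g ∈ W) :
    IsLocalLift c c' (fun x : X => g • x) A (fun z => F (g, z)) where
  isOpen := h.isOpen_right
  subset := h.subset
  mapsTo := fun _ hz => h.mapsTo ⟨hg, hz⟩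
  smooth := fun _ hz => (h.contDiffAt_right hg hz).contDiffWithinAt
  comm := fun z hz => h.comm g hg z hz

theorem mono (h : IsActionLift EG c c' W A F) {B : Set E} (hB : IsOpen B) (hBA : B ⊆ A) :
    IsActionLift EG c c' W B F where
  isOpen_left := h.isOpen_left
  isOpen_right := hB
  subset := hBA.trans h.subset
  mapsTo := h.mapsTo.mono_left (prod_mono_right hBA)
  smooth := h.smooth.mono (prod_mono_right hBA)
  comm := fun g hg w hw => h.comm g hg w (hBA hw)

end IsActionLift

namespace IsSmoothAction

variable [Orbifold E X]

theorem orbifoldSmooth (h : IsSmoothAction EG G E X) (g : G) :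
    OrbifoldSmooth E (fun x : X => g • x) := by
  intro c hc c' hc' v hv v' hv' he
  obtain ⟨W, A, F, hg, hvA, hF, hL⟩ := h c hc c' hc' g v hv v' hv' he
  exact ⟨A, _, hvA, hF, hL.isLocalLift hg⟩

theorem continuous_smul_const (h : IsSmoothAction EG G E X) (x : X) :
    Continuous (fun g : G => g • x) := by
  refine continuous_iff_continuousAt.2 fun g => ?_
  obtain ⟨c, hc, w, hw, rfl⟩ := exists_chart_eq E x
  obtain ⟨c', hc', w', hw', he⟩ := exists_chart_eq E (g • c.proj w)
  obtain ⟨W, A, F, hg, hvA, hF, hL⟩ := h c hc c' hc' g w hw w' hw' he.symm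
  have h1 : ContinuousAt (fun k => c'.proj (F (k, w))) g :=
    ContinuousAt.comp (f := fun k => F (k, w)) (c'.continuousAt_proj (hL.mapsTo ⟨hg, hvA⟩))
      (hL.contMDiffAt_left hg hvA).continuousAt
  refine h1.congr ?_
  filter_upwards [hL.isOpen_left.mem_nhds hg] with k hk using hL.comm k hk w hvA

/-- Infinitesimal generators exist at points where the chart projection is locally injective. -/
theorem exists_isGeneratorAt (h : IsSmoothAction EG G E X) {c : OrbifoldChart E X}
    (hc : c ∈ Orbifold.atlas (E := E) (X := X)) {w : E} (hw : w ∈ c.dom)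
    (hinj : LocInjAt c.proj w) (ξ : GroupLieAlgebra 𝓘(ℝ, EG) G) :
    ∃ v, IsGeneratorAt c w ξ v := by
  obtain ⟨W, A, F, h1, hwA, hF, hL⟩ := h c hc c hc (1 : G) w hw w hw (one_smul G _)
  have hcont : Tendsto (fun z => F (1, z)) (𝓝 w) (𝓝 w) := by
    have := (hL.contDiffAt_right h1 hwA).continuousAt
    rwa [ContinuousAt, hF] at this
  have hA : A ∈ 𝓝 w := hL.isOpen_right.mem_nhds hwA
  -- `F (1, ·)` lifts the identity and fixes `w`, so local injectivity makes it the identity on a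
  -- smaller neighbourhood.
  have hid : ∀ᶠ z in 𝓝 w, F (1, z) = z := hinj.eventually_eq hcont tendsto_id <| by
    filter_upwards [hA] with z hz
    exact (hL.comm 1 h1 z hz).trans (one_smul G _)
  obtain ⟨B, hB, hBo, hwB⟩ := mem_nhds_iff.1 (inter_mem hid hA)
  exact ⟨_, W, B, F, hL.mono hBo fun z hz => (hB hz).2, h1, hwB, fun z hz => (hB hz).1, rfl⟩

end IsSmoothAction

/-- Maps that intertwine two actions up to conjugation by `a` transport infinitesimal generators. -/
theorem IsGeneratorAt.fderiv_eq [LieGroup 𝓘(ℝ, EG) ∞ G] {c : OrbifoldChart E X}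
    {c' : OrbifoldChart E Y} {f : X → Y} {A : Set E} {φ : E → E} (hφ : IsLocalLift c c' f A φ)
    {w : E} (hw : w ∈ A) (hinj : LocInjAt c'.proj (φ w)) {a : G}
    (hf : ∀ (k : G) (x : X), f (k • x) = (a * k * a⁻¹) • f x)
    {ξ : GroupLieAlgebra 𝓘(ℝ, EG) G} {v v' : E} (hv : IsGeneratorAt c w ξ v)
    (hv' : IsGeneratorAt c' (φ w) (Ad EG a ξ) v') : fderiv ℝ φ w v = v' := by
  obtain ⟨W, B, F, hF, h1, hwB, hF1, rfl⟩ := hv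
  obtain ⟨W', B', F', hF', h1', hwB', hF1', rfl⟩ := hv'
  have : IsTopologicalGroup G := topologicalGroup_of_lieGroup 𝓘(ℝ, EG) ∞
  have hFw := hF.contMDiffAt_left h1 hwB
  have hFw' := hF'.contMDiffAt_left h1' hwB'
  have hconj : Tendsto (fun k : G => a * k * a⁻¹) (𝓝 1) (𝓝 1) := by
    have : Continuous (fun k : G => a * k * a⁻¹) := by fun_prop
    simpa using this.tendsto 1
  have hα0 : Tendsto (fun k => F (k, w)) (𝓝 1) (𝓝 w) := by
    have := hFw.continuousAt
    rwa [ContinuousAt, hF1 w hwB] at this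
  have hα : Tendsto (fun k => φ (F (k, w))) (𝓝 1) (𝓝 (φ w)) :=
    (hφ.continuousAt hw).tendsto.comp hα0
  have hβ : Tendsto (fun k => F' (a * k * a⁻¹, φ w)) (𝓝 1) (𝓝 (φ w)) := by
    have := hFw'.continuousAt
    rw [ContinuousAt, hF1' _ hwB'] at this
    exact this.comp hconj
  -- Both sides lift the same orbit map near `φ w`, where the chart projection is injective.
  have heq : (fun k => φ (F (k, w))) =ᶠ[𝓝 1] fun k => F' (a * k * a⁻¹, φ w) := by
    refine hinj.eventually_eq hα hβ ?_
    filter_upwards [hF.isOpen_left.mem_nhds h1, hα0 (hφ.mem_nhds hw),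
      hconj (hF'.isOpen_left.mem_nhds h1')] with k hk hkA hk'
    rw [hφ.comm _ hkA, hF.comm k hk w hwB, hf, hF'.comm _ hk' _ hwB', hφ.comm w hw]
  have h2 : (mfderiv 𝓘(ℝ, EG) 𝓘(ℝ, E) (fun k => φ (F (k, w))) 1 : EG → E) ξ =
      fderiv ℝ φ w ((mfderiv 𝓘(ℝ, EG) 𝓘(ℝ, E) (fun k => F (k, w)) 1 : EG → E) ξ) := by
    refine (mfderiv_comp_apply_of_eq (x := (1 : G)) (y := w) (f := fun k => F (k, w)) (g := φ)
      (hφ.differentiableAt hw).mdifferentiableAt (hFw.mdifferentiableAt (by simp))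
      (hF1 w hwB) ξ).trans ?_
    rw [mfderiv_eq_fderiv]
    rfl
  have h3 : (mfderiv 𝓘(ℝ, EG) 𝓘(ℝ, E) (fun k => φ (F (k, w))) 1 : EG → E) ξ =
      (mfderiv 𝓘(ℝ, EG) 𝓘(ℝ, E) (fun k => F' (a * k * a⁻¹, φ w)) 1 : EG → E) ξ := by
    have := heq.mfderiv_eq (I := 𝓘(ℝ, EG)) (I' := 𝓘(ℝ, E))
    exact congrArg (fun T : EG →L[ℝ] E => T ξ) this
  exact h2.symm.trans (h3.trans (mfderiv_comp_conj (hFw'.mdifferentiableAt (by simp)) a ξ))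

/-- A generator at `w` extends to a continuous field of generators near `w`. -/
theorem IsGeneratorAt.exists_field [LieGroup 𝓘(ℝ, EG) ∞ G] {c : OrbifoldChart E X} {w : E}
    {ξ : GroupLieAlgebra 𝓘(ℝ, EG) G} {v : E} (hv : IsGeneratorAt c w ξ v) :
    ∃ V : E → E, V w = v ∧ ContinuousAt V w ∧ ∀ᶠ z in 𝓝 w, IsGeneratorAt c z ξ (V z) := by
  obtain ⟨W, B, F, hF, h1, hwB, hF1, rfl⟩ := hv
  refine ⟨fun z => (mfderiv 𝓘(ℝ, EG) 𝓘(ℝ, E) (fun g : G => F (g, z)) 1 : EG → E) ξ, rfl, ?_, ?_⟩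
  · set φ := extChartAt 𝓘(ℝ, EG) (1 : G)
    set Q : EG × E → E := fun q => F (φ.symm q.1, q.2) with hQ
    have hQd : ∀ z ∈ B, ContDiffAt ℝ ∞ Q (φ 1, z) := by
      intro z hz
      rw [← contMDiffAt_iff_contDiffAt]
      have hs1 : φ.symm (φ 1) = 1 := extChartAt_to_inv (1 : G)
      have k1 : ContMDiffAt 𝓘(ℝ, EG × E) 𝓘(ℝ, EG) ∞ (fun q : EG × E => φ.symm q.1) (φ 1, z) :=
        ContMDiffAt.comp (φ 1, z) (contMDiffAt_chart_symm (mem_extChartAt_target (1 : G)))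
          contDiff_fst.contDiffAt.contMDiffAt
      have k2 : ContMDiffAt 𝓘(ℝ, EG × E) 𝓘(ℝ, E) ∞ (fun q : EG × E => q.2) (φ 1, z) :=
        contDiff_snd.contDiffAt.contMDiffAt
      exact ContMDiffAt.comp_of_eq (hF.contMDiffAt h1 hz) (k1.prodMk k2) (by simp [hs1])
    have hval : ∀ᶠ z in 𝓝 w, fderiv ℝ Q (φ 1, z) (ξ, 0) =
        (mfderiv 𝓘(ℝ, EG) 𝓘(ℝ, E) (fun g : G => F (g, z)) 1 : EG → E) ξ := by
      filter_upwards [hF.isOpen_right.mem_nhds hwB] with z hz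
      refine Eq.trans ?_ (mfderiv_eq_fderiv_chart
        ((hF.contMDiffAt_left h1 hz).mdifferentiableAt (by simp)) ξ).symm
      have k1 : HasFDerivAt (fun y => Q (y, z)) _ (φ 1) :=
        HasFDerivAt.comp (φ 1) (f := fun y : EG => (y, z))
          ((hQd z hz).differentiableAt (by simp)).hasFDerivAt (hasFDerivAt_prodMk_left (φ 1) z)
      have k2 : ((fun g : G => F (g, z)) ∘ φ.symm) = fun y => Q (y, z) := rfl
      rw [k2, k1.fderiv]
      exact congrArg (fderiv ℝ Q (φ 1, z)) (by simp)
    refine ContinuousAt.congr ?_ hval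
    have k3 : ContinuousAt (fderiv ℝ Q) (φ 1, w) :=
      ((hQd w hwB).fderiv_right (m := 0) (by simp)).continuousAt
    have k4 : ContinuousAt (fun z => fderiv ℝ Q (φ 1, z)) w :=
      ContinuousAt.comp (f := fun z : E => (φ 1, z)) k3 (by fun_prop)
    exact k4.clm_apply continuousAt_const
  · filter_upwards [hF.isOpen_right.mem_nhds hwB] with z hz
    exact ⟨W, B, F, hF, h1, hz, hF1, rfl⟩

end ActionLifts

/-! ### Invariance of the pulled-back form. -/

section Pullback

variable {E : Type*} [NormedAddCommGroup E] [NormedSpace ℝ E]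
  {X : Type*} [TopologicalSpace X] [Orbifold E X] {Y : Type*} [TopologicalSpace Y] [Orbifold E Y]

/-- If `σt = p^* σ` and `k ∘ p ∘ f = p` for a map `k` that preserves `σ`, then `f` preserves `σt`. -/
theorem isPullback_of_comp_eq {n : ℕ} {p : X → Y} {σt : OrbifoldForm E X n} {σ : OrbifoldForm E Y n}
    (hσt : IsPullback p σ.toFun σt.toFun) (hp : OrbifoldSmooth E p) {f : X → X} {k : Y → Y}
    (hk : OrbifoldSmooth E k) (hkσ : IsPullback k σ.toFun σ.toFun) (hf : k ∘ p ∘ f = p) :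
    IsPullback f σt.toFun σt.toFun := by
  intro c hc c' hc' A φ hφ w hw
  have hφw := hφ.mapsTo hw
  obtain ⟨d, hd, v, hv, hdv⟩ := exists_chart_eq E (p (c'.proj (φ w)))
  obtain ⟨B, ψ, hB, hψv, hψ⟩ := hp c' hc' d hd (φ w) hφw v hv hdv.symm
  obtain ⟨d', hd', v', hv', hdv'⟩ := exists_chart_eq E (k (d.proj v))
  obtain ⟨C, κ, hC, hκv, hκ⟩ := hk d hd d' hd' v hv v' hv' hdv'.symm
  subst hψv
  -- This composite is also a local lift of `p`, so `σt` in the chart `c` is the pullback of `σ`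
  -- along it.
  have hL : IsLocalLift c d' (k ∘ p ∘ f) _ (κ ∘ ψ ∘ φ) := hκ.comp (hψ.comp hφ)
  rw [hf] at hL
  have e1 := hσt c hc d' hd' _ _ hL w ⟨⟨hw, hB⟩, hC⟩
  have e2 := hσt c' hc' d hd _ _ hψ (φ w) hB
  have e3 := hkσ d hd d' hd' _ _ hκ (ψ (φ w)) hC
  have hd1 : DifferentiableAt ℝ φ w := hφ.differentiableAt hw
  have hd2 : DifferentiableAt ℝ ψ (φ w) := hψ.differentiableAt hB
  have hd3 : DifferentiableAt ℝ κ (ψ (φ w)) := hκ.differentiableAt hC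
  have hD : fderiv ℝ (κ ∘ ψ ∘ φ) w = (fderiv ℝ κ (ψ (φ w))).comp
      ((fderiv ℝ ψ (φ w)).comp (fderiv ℝ φ w)) := by
    rw [← fderiv_comp w hd2 hd1]
    exact fderiv_comp w (g := κ) (f := ψ ∘ φ) hd3 (hd2.comp w hd1)
  rw [e1, e2, e3, hD]
  rfl

theorem compContinuousLinearMap_vec_two {V W : Type*} [NormedAddCommGroup V] [NormedSpace ℝ V]
    [NormedAddCommGroup W] [NormedSpace ℝ W] (β : W [⋀^Fin 2]→L[ℝ] ℝ) (T : V →L[ℝ] W) (v u : V) :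
    β.compContinuousLinearMap T ![v, u] = β ![T v, T u] := by
  rw [ContinuousAlternatingMap.compContinuousLinearMap_apply]
  congr 1
  ext i
  fin_cases i <;> rfl

end Pullback

/-! ### Displacement of momentum maps under symplectic maps. -/

section Momentum

variable {EG : Type*} [NormedAddCommGroup EG] [NormedSpace ℝ EG]
  {G : Type*} [TopologicalSpace G] [ChartedSpace EG G] [Group G] [LieGroup 𝓘(ℝ, EG) ∞ G]
  {E : Type*} [NormedAddCommGroup E] [NormedSpace ℝ E]
  {X : Type*} [TopologicalSpace X] [MulAction G X] [Orbifold E X]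

namespace IsMomentumMap

variable {σ : OrbifoldForm E X 2} {J : X → LieDual EG G}

theorem contDiffAt (hJ : IsMomentumMap σ J) (ξ : GroupLieAlgebra 𝓘(ℝ, EG) G)
    {c : OrbifoldChart E X} (hc : c ∈ Orbifold.atlas (E := E) (X := X)) {w : E} (hw : w ∈ c.dom) :
    ContDiffAt ℝ ∞ (fun z => J (c.proj z) ξ) w :=
  (hJ.smooth ξ c hc).contDiffAt (c.dom_mem_nhds hw)

theorem continuous (hJ : IsMomentumMap σ J) (ξ : GroupLieAlgebra 𝓘(ℝ, EG) G) :
    Continuous (fun x => J x ξ) := by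
  refine continuous_iff_continuousAt.2 fun x => ?_
  obtain ⟨c, hc, w, hw, rfl⟩ := exists_chart_eq E x
  rw [ContinuousAt, ← c.map_proj_nhds hw, tendsto_map'_iff]
  exact (hJ.contDiffAt ξ hc hw).continuousAt

/-- The lift `φ` preserves the form and takes the generator of `ξ` to that of `Ad a ξ`, so
contracting the form with either gives the same differential. Local injectivity supplies the
generators and makes them correspond. -/
theorem fderiv_comp_sub_eq_zero (hX : IsSmoothAction EG G E X) (hJ : IsMomentumMap σ J)
    {f : X → X} (hfσ : IsPullback f σ.toFun σ.toFun) {a : G}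
    (hfa : ∀ (k : G) (x : X), f (k • x) = (a * k * a⁻¹) • f x) (ξ : GroupLieAlgebra 𝓘(ℝ, EG) G)
    {c c' : OrbifoldChart E X} (hc : c ∈ Orbifold.atlas (E := E) (X := X))
    (hc' : c' ∈ Orbifold.atlas (E := E) (X := X)) {A : Set E} {φ : E → E}
    (hφ : IsLocalLift c c' f A φ) {w : E} (hw : w ∈ A) (hr : LocInjAt c.proj w)
    (hr' : LocInjAt c'.proj (φ w)) :
    fderiv ℝ (fun z => J (f (c.proj z)) (Ad EG a ξ) - J (c.proj z) ξ) w = 0 := by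
  obtain ⟨v, hv⟩ := hX.exists_isGeneratorAt hc (hφ.subset hw) hr ξ
  obtain ⟨v', hv'⟩ := hX.exists_isGeneratorAt hc' (hφ.mapsTo hw) hr' (Ad EG a ξ)
  have hvv' : fderiv ℝ φ w v = v' := IsGeneratorAt.fderiv_eq hφ hw hr' hfa hv hv'
  have hJ1 := (hJ.contDiffAt ξ hc (hφ.subset hw)).differentiableAt (by simp)
  have hJ2 := (hJ.contDiffAt (Ad EG a ξ) hc' (hφ.mapsTo hw)).differentiableAt (by simp)
  have hcomp : HasFDerivAt (fun z => J (c'.proj (φ z)) (Ad EG a ξ)) _ w :=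
    HasFDerivAt.comp w hJ2.hasFDerivAt (hφ.differentiableAt hw).hasFDerivAt
  have heq : (fun z => J (f (c.proj z)) (Ad EG a ξ) - J (c.proj z) ξ) =ᶠ[𝓝 w]
      fun z => J (c'.proj (φ z)) (Ad EG a ξ) - J (c.proj z) ξ := by
    filter_upwards [hφ.mem_nhds hw] with z hz
    rw [hφ.comm z hz]
  rw [heq.fderiv_eq, (hcomp.fun_sub hJ1.hasFDerivAt).fderiv]
  ext u
  have h1 := hJ.generates ξ c hc w (hφ.subset hw) v hv u
  have h2 := hJ.generates _ c' hc' (φ w) (hφ.mapsTo hw) v' hv' (fderiv ℝ φ w u)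
  rw [hfσ c hc c' hc' A φ hφ w hw, compContinuousLinearMap_vec_two, hvv', h2] at h1
  simp [h1]

/-- A symplectic map that intertwines the action up to conjugation by `a` intertwines the momentum
map up to `Ad a` and up to a constant. -/
theorem comp_sub_eq_const [PreconnectedSpace X] (hX : IsSmoothAction EG G E X)
    (hJ : IsMomentumMap σ J) {f : X → X} (hf : OrbifoldSmooth E f) (hfo : IsOpenMap f)
    (hfσ : IsPullback f σ.toFun σ.toFun) {a : G}
    (hfa : ∀ (k : G) (x : X), f (k • x) = (a * k * a⁻¹) • f x) (ξ : GroupLieAlgebra 𝓘(ℝ, EG) G)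
    (x y : X) : J (f x) (Ad EG a ξ) - J x ξ = J (f y) (Ad EG a ξ) - J y ξ := by
  refine IsLocallyConstant.apply_eq_of_preconnectedSpace
    (f := fun x => J (f x) (Ad EG a ξ) - J x ξ) ?_ x y
  refine (IsLocallyConstant.iff_eventually_eq _).2 fun x => ?_
  obtain ⟨c, hc, w, hw, rfl⟩ := exists_chart_eq E x
  have hsmooth : ∀ z ∈ c.dom,
      ContDiffAt ℝ ∞ (fun z => J (f (c.proj z)) (Ad EG a ξ) - J (c.proj z) ξ) z := by
    intro z hz
    obtain ⟨c', hc', z', hz', he⟩ := exists_chart_eq E (f (c.proj z))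
    obtain ⟨A, φ, hzA, hφz, hφ⟩ := hf c hc c' hc' z hz z' hz' he.symm
    refine ContDiffAt.sub ?_ (hJ.contDiffAt ξ hc hz)
    have h1 : ContDiffAt ℝ ∞ (fun z => J (c'.proj (φ z)) (Ad EG a ξ)) z :=
      ContDiffAt.comp z (hJ.contDiffAt (Ad EG a ξ) hc' (hφ.mapsTo hzA)) (hφ.contDiffAt hzA)
    refine h1.congr_of_eventuallyEq ?_
    filter_upwards [hφ.mem_nhds hzA] with y hy
    rw [hφ.comm y hy]
  have hzero : c.dom.EqOn
      (fderiv ℝ (fun z => J (f (c.proj z)) (Ad EG a ξ) - J (c.proj z) ξ)) 0 := by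
    intro z hz
    have hfr := frequently_isRegularPoint_and E hfo hf.continuous (c.proj z)
    rw [← c.map_proj_nhds hz, frequently_map] at hfr
    -- The derivative is continuous and vanishes at the dense set of regular points with regular
    -- image.
    refine isClosed_singleton.mem_of_frequently_of_tendsto ?_
      ((hsmooth z hz).fderiv_right (m := 0) (by simp)).continuousAt
    refine (hfr.and_eventually (c.dom_mem_nhds hz)).mono fun y hy => ?_
    obtain ⟨c', hc', y', hy', he⟩ := exists_chart_eq E (f (c.proj y))
    obtain ⟨A, φ, hyA, hφy, hφ⟩ := hf c hc c' hc' y hy.2 y' hy' he.symm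
    refine hJ.fderiv_comp_sub_eq_zero hX hfσ hfa ξ hc hc' hφ hyA
      (hy.1.1.locInjAt (mem_maximalAtlas hc) hy.2) ?_
    rw [hφy]
    refine IsRegularPoint.locInjAt (mem_maximalAtlas hc') hy' ?_
    rw [he]
    exact hy.1.2
  rw [← c.map_proj_nhds hw, eventually_map]
  filter_upwards [c.dom_mem_nhds hw] with z hz
  exact c.isOpen_dom.is_const_of_fderiv_eq_zero (𝕜 := ℝ) c.isConnected_dom.isPreconnected
    (fun y hy => ((hsmooth y hy).differentiableAt (by simp)).differentiableWithinAt) hzero hz hw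

theorem comp_sub_eq_const_of_commute [PreconnectedSpace X] (hX : IsSmoothAction EG G E X)
    (hJ : IsMomentumMap σ J) {f : X → X} (hf : OrbifoldSmooth E f) (hfo : IsOpenMap f)
    (hfσ : IsPullback f σ.toFun σ.toFun) (hfc : ∀ (k : G) (x : X), f (k • x) = k • f x)
    (x y : X) : J (f x) - J x = J (f y) - J y := by
  ext ξ
  have := hJ.comp_sub_eq_const hX hf hfo hfσ (a := 1) (by simpa using hfc) ξ x y
  rw [Ad_one] at this
  simpa using this

/-- The displacement of the momentum map under a symplectic map that commutes with the
action is invariant under the adjoint representation. -/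
theorem comp_sub_Ad_invariant [PreconnectedSpace X] (hX : IsSmoothAction EG G E X)
    (hJ : IsMomentumMap σ J) (hinv : IsInvariantForm G σ) {f : X → X} (hf : OrbifoldSmooth E f)
    (hfo : IsOpenMap f) (hfσ : IsPullback f σ.toFun σ.toFun)
    (hfc : ∀ (k : G) (x : X), f (k • x) = k • f x) (x : X) (g : G)
    (ξ : GroupLieAlgebra 𝓘(ℝ, EG) G) : (J (f x) - J x) (Ad EG g ξ) = (J (f x) - J x) ξ := by
  have hgo : IsOpenMap (fun x : X => g • x) := by
    refine IsOpenMap.of_inverse (f' := fun x : X => g⁻¹ • x)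
      (hX.orbifoldSmooth g⁻¹).continuous ?_ ?_
    · intro y; simp
    · intro y; simp
  -- The failure of equivariance under `g` is the same at `x` and at `f x`, so it cancels in the
  -- displacement.
  have h1 := hJ.comp_sub_eq_const hX (hX.orbifoldSmooth g) hgo (hinv g) (a := g)
    (fun k x => by simp [mul_smul]) ξ x (f x)
  have h2 := congrArg (fun μ : LieDual EG G => μ (Ad EG g ξ))
    (hJ.comp_sub_eq_const_of_commute hX hf hfo hfσ hfc x (g • x))
  simp only [LinearMap.sub_apply, hfc] at h2 ⊢
  linarith

end IsMomentumMap

end Momentum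

/-! ### Maps over the base commute with the action; descent to the base. -/

section CoveringAction

variable {EG : Type*} [NormedAddCommGroup EG] [NormedSpace ℝ EG]
  {G : Type*} [TopologicalSpace G] [ChartedSpace EG G] [Group G] [LieGroup 𝓘(ℝ, EG) ∞ G]
  {E : Type*} [NormedAddCommGroup E] [NormedSpace ℝ E]
  {X : Type*} [TopologicalSpace X] [MulAction G X] [Orbifold E X]
  {Y : Type*} [TopologicalSpace Y] [MulAction G Y] [Orbifold E Y] {p : X → Y}

/-- Over regular points, maps over the base of a covering commute with lifted actions of
connected groups. -/
theorem IsOrbifoldCovering.map_smul_of_isRegularPoint [ConnectedSpace G] [T2Space X]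
    (hp : IsOrbifoldCovering E p) (hX : IsSmoothAction EG G E X)
    (hlift : ∀ (g : G) (x : X), p (g • x) = g • p x) {r : X → X} (hr : Continuous r)
    (hpr : ∀ x, p (r x) = p x) {x : X} (hx : IsRegularPoint E (p x)) (g : G) :
    r (g • x) = g • r x := by
  have : IsTopologicalGroup G := topologicalGroup_of_lieGroup 𝓘(ℝ, EG) ∞
  set S : Set G := {g | r (g • x) = g • r x} with hS
  have hc1 : Continuous fun g : G => r (g • x) := hr.comp (hX.continuous_smul_const x)
  have hc2 : Continuous fun g : G => g • r x := hX.continuous_smul_const (r x)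
  suffices S = univ from (this ▸ mem_univ g : g ∈ S)
  refine IsClopen.eq_univ ⟨isClosed_eq hc1 hc2, isOpen_iff_mem_nhds.2 fun g₀ hg₀ => ?_⟩
    ⟨1, by simp [hS]⟩
  have hinj : LocInjAt p (r x) := hp.locInjAt (by rwa [hpr])
  -- Translating by `g₀⁻¹` brings both curves to `r x`, where `p` is known to be locally injective;
  -- they have the same projection.
  have ha : Tendsto (fun g : G => g₀⁻¹ • r (g • x)) (𝓝 g₀) (𝓝 (r x)) := by
    have := ((hX.orbifoldSmooth g₀⁻¹).continuous.comp hc1).tendsto g₀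
    simp only [Function.comp_apply] at this
    rwa [show r (g₀ • x) = g₀ • r x from hg₀, inv_smul_smul] at this
  have hb : Tendsto (fun g : G => (g₀⁻¹ * g) • r x) (𝓝 g₀) (𝓝 (r x)) := by
    have := (hc2.comp (continuous_const_mul g₀⁻¹)).tendsto g₀
    simpa [Function.comp_def] using this
  have hev := hinj.eventually_eq ha hb (Eventually.of_forall fun g => by
    rw [hlift, hpr, hlift, hlift, hpr, mul_smul])
  filter_upwards [hev] with g hg
  have := congrArg (fun y => g₀ • y) hg
  simpa [hS, mul_smul] using this

/-- Equality is a closed condition and holds over the regular points, whose preimage is dense. -/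
theorem IsOrbifoldCovering.map_smul [ConnectedSpace G] [T2Space X]
    (hp : IsOrbifoldCovering E p) (hX : IsSmoothAction EG G E X)
    (hlift : ∀ (g : G) (x : X), p (g • x) = g • p x) {r : X → X} (hr : Continuous r)
    (hpr : ∀ x, p (r x) = p x) (g : G) (x : X) : r (g • x) = g • r x := by
  have hg := (hX.orbifoldSmooth g).continuous
  have hcl : IsClosed {x : X | r (g • x) = g • r x} := isClosed_eq (hr.comp hg) (hg.comp hr)
  have hfr := frequently_isRegularPoint_and E hp.isOpenMap hp.smooth.continuous x
  exact hcl.mem_of_frequently_of_tendsto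
    (hfr.mono fun y hy => hp.map_smul_of_isRegularPoint hX hlift hr hpr hy.2 g) tendsto_id

/-- A momentum map which is constant on the regular fibres of a covering is constant on all
fibres. -/
theorem IsOrbifoldCovering.momentum_eq_of_fiber (hp : IsOrbifoldCovering E p)
    {σ : OrbifoldForm E X 2} {J : X → LieDual EG G} (hJ : IsMomentumMap σ J)
    (hreg : ∀ x x', p x = p x' → IsRegularPoint E (p x) → J x = J x') {x x' : X}
    (h : p x = p x') : J x = J x' := by
  obtain ⟨e, he, hx, hd⟩ := hp.exists_chart_at (p x)
  obtain ⟨d, -, hdom, ⟨w, hw, rfl⟩, hproj⟩ := hd x hx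
  obtain ⟨d', -, hdom', ⟨w', hw', rfl⟩, hproj'⟩ := hd x' (h ▸ hx)
  rw [hproj w hw, hproj' w' hw'] at h
  rw [hdom] at hw hproj
  rw [hdom'] at hw' hproj'
  -- The two points can now be moved together: `d.proj z` and `d'.proj (g z)` stay in one fibre,
  -- which is regular for `z` arbitrarily close to `w`.
  obtain ⟨g, rfl⟩ := (e.proj_eq_iff w hw w' hw').1 h
  ext ξ
  have h1 : ContinuousAt (fun z => J (d.proj z) ξ) w :=
    ContinuousAt.comp (f := d.proj) (hJ.continuous ξ).continuousAt (d.continuousAt_proj (hdom ▸ hw))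
  have h2 : ContinuousAt (fun z => J (d'.proj (e.act g z)) ξ) w :=
    ContinuousAt.comp (f := fun z => d'.proj (e.act g z)) (hJ.continuous ξ).continuousAt
      (ContinuousAt.comp (f := e.act g) (d'.continuousAt_proj (hdom' ▸ hw'))
        (e.contDiffAt_act g hw).continuousAt)
  have hfr := frequently_isRegularPoint E (e.proj w)
  rw [← e.map_proj_nhds hw, frequently_map] at hfr
  refine eq_of_frequently_eq_of_tendsto h1 h2 ?_
  refine (hfr.and_eventually (e.dom_mem_nhds hw)).mono fun z hz => ?_
  have hgz := e.act_mapsTo g hz.2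
  have := hreg (d.proj z) (d'.proj (e.act g z))
    (by rw [hproj z hz.2, hproj' _ hgz, e.proj_act g hz.2]) (by rw [hproj z hz.2]; exact hz.1)
  exact congrArg (fun μ : LieDual EG G => μ ξ) this

/-- A momentum map on a covering orbifold that factors through the base descends to a momentum
map. -/
theorem IsMomentumMap.descend (hp : IsOrbifoldCovering E p) (hsurj : Function.Surjective p)
    (hX : IsSmoothAction EG G E X) (hlift : ∀ (g : G) (x : X), p (g • x) = g • p x)
    {σ : OrbifoldForm E Y 2} {σt : OrbifoldForm E X 2} (hσt : IsPullback p σ.toFun σt.toFun)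
    {J : Y → LieDual EG G} (hJ : IsMomentumMap σt (J ∘ p)) : IsMomentumMap σ J := by
  have hloc : ∀ c ∈ Orbifold.atlas (E := E) (X := Y), ∀ w ∈ c.dom,
      ∃ c₁ ∈ Orbifold.atlas (E := E) (X := X), ∃ u φ, IsDiffeoLift c₁ c p u w φ := by
    intro c hc w hw
    obtain ⟨x, hx⟩ := hsurj (c.proj w)
    obtain ⟨c₁, hc₁, u, hu, rfl⟩ := exists_chart_eq E x
    obtain ⟨φ, hφ⟩ := hp.exists_diffeoLift hc₁ hc hu hw hx
    exact ⟨c₁, hc₁, u, φ, hφ⟩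
  have hsm : ∀ ξ : GroupLieAlgebra 𝓘(ℝ, EG) G, ∀ c ∈ Orbifold.atlas (E := E) (X := Y),
      ∀ w ∈ c.dom, ContDiffAt ℝ ∞ (fun z => J (c.proj z) ξ) w := by
    intro ξ c hc w hw
    obtain ⟨c₁, hc₁, u, φ, hφ⟩ := hloc c hc w hw
    have hu : φ.symm w ∈ c₁.dom := by
      rw [hφ.symm_eq]; exact hφ.lift.subset hφ.mem_source
    have h1 : ContDiffAt ℝ ∞ (fun z => (J ∘ p) (c₁.proj (φ.symm z)) ξ) w :=
      ContDiffAt.comp w (hJ.contDiffAt ξ hc₁ hu) (hφ.contDiffAt_symm hφ.mem_target)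
    refine h1.congr_of_eventuallyEq ?_
    filter_upwards [φ.open_target.mem_nhds hφ.mem_target] with z hz
    rw [Function.comp_apply, hφ.comm_symm hz]
  refine ⟨fun ξ c hc w hw => (hsm ξ c hc w hw).contDiffWithinAt, ?_⟩
  intro ξ c hc w hw v hv s
  obtain ⟨c₁, hc₁, u, φ, hφ⟩ := hloc c hc w hw
  -- At a singular point the generator need not be known to come from one upstairs. It is extended
  -- to a continuous field so that the momentum equation can be checked at nearby regular points.
  obtain ⟨V, rfl, hVc, hVg⟩ := hv.exists_field
  have hcl : ContinuousAt (fun z => σ.toFun c z ![V z, s]) w := by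
    have h1 : ContinuousAt (σ.toFun c) w :=
      ((σ.smooth c hc).contDiffAt (c.dom_mem_nhds hw)).continuousAt
    have h2 : ContinuousAt (fun z => ![V z, s]) w := by
      refine continuousAt_pi.2 fun i => ?_
      fin_cases i
      exacts [hVc, continuousAt_const]
    exact h1.eval h2
  have hcr : ContinuousAt (fun z => fderiv ℝ (fun z => J (c.proj z) ξ) z s) w :=
    ((hsm ξ c hc w hw).fderiv_right (m := 0) (by simp)).continuousAt.clm_apply continuousAt_const
  refine eq_of_frequently_eq_of_tendsto hcl hcr ?_
  have hu := hφ.lift.subset hφ.mem_source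
  have hfr := frequently_isRegularPoint_and E hp.isOpenMap hp.smooth.continuous (c₁.proj u)
  rw [← c₁.map_proj_nhds hu, frequently_map] at hfr
  rw [← hφ.map_nhds] at hVg ⊢
  rw [frequently_map]
  have hsrc : ∀ᶠ y in 𝓝 u, y ∈ φ.source := φ.open_source.mem_nhds hφ.mem_source
  refine (hfr.and_eventually (hsrc.and (eventually_map.1 hVg))).mono ?_
  rintro y ⟨⟨hy1, hy2⟩, hys, hyV⟩
  have hyd := hφ.lift.subset hys
  have hyd' := hφ.lift.mapsTo hys
  rw [← hφ.lift.comm y hys] at hy2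
  obtain ⟨vt, hvt⟩ := hX.exists_isGeneratorAt hc₁ hyd (hy1.locInjAt (mem_maximalAtlas hc₁) hyd) ξ
  have hDv : fderiv ℝ φ y vt = V (φ y) := by
    refine IsGeneratorAt.fderiv_eq (f := p) (a := 1) hφ.lift hys
      (hy2.locInjAt (mem_maximalAtlas hc) hyd') (by simpa using hlift) hvt ?_
    rwa [Ad_one]
  have hDs : fderiv ℝ φ y (fderiv ℝ φ.symm (φ y) s) = s := by
    have h1 : HasFDerivAt (φ ∘ φ.symm) ((fderiv ℝ φ y).comp (fderiv ℝ φ.symm (φ y))) (φ y) := by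
      refine HasFDerivAt.comp (φ y) ?_
        ((hφ.contDiffAt_symm (φ.map_source hys)).differentiableAt (by simp)).hasFDerivAt
      rw [φ.left_inv hys]
      exact (hφ.lift.differentiableAt hys).hasFDerivAt
    have h2 : HasFDerivAt (φ ∘ φ.symm) (ContinuousLinearMap.id ℝ E) (φ y) := by
      refine (hasFDerivAt_id (φ y)).congr_of_eventuallyEq ?_
      filter_upwards [φ.open_target.mem_nhds (φ.map_source hys)] with z hz using φ.right_inv hz
    exact congrArg (fun T : E →L[ℝ] E => T s) (h1.unique h2)
  -- The test vector is the preimage of `s` under the derivative of `φ`.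
  have hgen := hJ.generates ξ c₁ hc₁ y hyd vt hvt (fderiv ℝ φ.symm (φ y) s)
  have hJd : HasFDerivAt (fun z => J (c.proj (φ z)) ξ) _ y :=
    HasFDerivAt.comp y ((hsm ξ c hc _ hyd').differentiableAt (by simp)).hasFDerivAt
      (hφ.lift.differentiableAt hys).hasFDerivAt
  have heq : (fun z => (J ∘ p) (c₁.proj z) ξ) =ᶠ[𝓝 y] fun z => J (c.proj (φ z)) ξ := by
    filter_upwards [φ.open_source.mem_nhds hys] with z hz
    rw [Function.comp_apply, hφ.lift.comm z hz]
  rw [heq.fderiv_eq, hJd.fderiv, hσt c₁ hc₁ c hc _ _ hφ.lift y hys,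
    compContinuousLinearMap_vec_two, hDv, hDs, ContinuousLinearMap.comp_apply, hDs] at hgen
  exact hgen

end CoveringAction

/-! ### The annihilator of a summand is dual to its complement. -/

section Radical

variable {EG : Type*} [NormedAddCommGroup EG] [NormedSpace ℝ EG] [CompleteSpace EG]
  {G : Type*} [TopologicalSpace G] [ChartedSpace EG G] [Group G] [LieGroup 𝓘(ℝ, EG) ∞ G]

/-- Restriction of functionals identifies the annihilator of a submodule with the dual of any
complement. -/
theorem bijective_dualRestrict_comp_subtype {K V : Type*} [Field K] [AddCommGroup V] [Module K V]
    {D R : Submodule K V} (h : IsCompl D R) :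
    Function.Bijective (R.dualRestrict ∘ₗ D.dualAnnihilator.subtype) := by
  constructor
  · rw [injective_iff_map_eq_zero]
    rintro ⟨f, hf⟩ h0
    rw [Submodule.mem_dualAnnihilator] at hf
    ext x
    obtain ⟨d, hd, r, hr, rfl⟩ := Submodule.mem_sup.1 (h.sup_eq_top ▸ Submodule.mem_top (x := x))
    have h1 : f r = 0 := congrArg (fun l : Module.Dual K R => l ⟨r, hr⟩) h0
    simp [hf d hd, h1]
  · intro l
    refine ⟨⟨l ∘ₗ Submodule.projectionOnto R D h.symm, ?_⟩, ?_⟩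
    · rw [Submodule.mem_dualAnnihilator]
      intro d hd
      simp [(Submodule.projectionOnto_apply_eq_zero_iff h.symm).2 hd]
    · ext r
      simp [Submodule.projectionOnto_apply_left]

theorem restrictToRadical_bijective (h : IsCompl (derivedAlg EG G) (lieRadical EG G)) :
    Function.Bijective (restrictToRadical EG G) := by
  refine bijective_dualRestrict_comp_subtype ?_
  exact LieSubmodule.isCompl_toSubmodule.2 h

end Radical

end OrbifoldGeometry

/-! ### The proposition. -/

theorem proposition2p2
    -- a connected Lie group `G`
    {EG : Type*} [NormedAddCommGroup EG] [NormedSpace ℝ EG] [FiniteDimensional ℝ EG]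
    [CompleteSpace EG]
    {G : Type*} [TopologicalSpace G] [ChartedSpace EG G] [Group G] [LieGroup 𝓘(ℝ, EG) ∞ G]
    [ConnectedSpace G]
    -- a connected orbifold `M` with universal covering orbifold `p : Mt → M`
    {E : Type*} [NormedAddCommGroup E] [NormedSpace ℝ E] [FiniteDimensional ℝ E]
    {M Mt : Type u}
    [TopologicalSpace M] [T2Space M] [ConnectedSpace M] [OrbifoldGeometry.Orbifold E M]
    [TopologicalSpace Mt] [T2Space Mt] [OrbifoldGeometry.Orbifold E Mt]
    (p : Mt → M) (hp : OrbifoldGeometry.IsUniversalCovering E p)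
    -- a symplectic `G`-action on `(M, σ)`
    [MulAction G M] (hM : OrbifoldGeometry.IsSmoothAction EG G E M)
    (σ : OrbifoldGeometry.OrbifoldForm E M 2) (hσ : OrbifoldGeometry.IsSymplectic σ)
    (hinv : OrbifoldGeometry.IsInvariantForm G σ)
    -- a lift of the action to `Mt`, which commutes with the deck transformations
    [MulAction G Mt] (hMt : OrbifoldGeometry.IsSmoothAction EG G E Mt)
    (hlift : ∀ (g : G) (x : Mt), p (g • x) = g • p x)
    (hcomm : ∀ γ ∈ OrbifoldGeometry.DeckGroup E p, ∀ (g : G) (x : Mt), γ (g • x) = g • γ x)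
    -- the form `σt = p^* σ` and a momentum map `Jt` on `Mt`
    (σt : OrbifoldGeometry.OrbifoldForm E Mt 2)
    (hσt : OrbifoldGeometry.IsPullback p σ.toFun σt.toFun)
    (Jt : Mt → OrbifoldGeometry.LieDual EG G) (hJt : OrbifoldGeometry.IsMomentumMap σt Jt) :
    (∃ h : OrbifoldGeometry.DeckGroup E p →* Multiplicative (OrbifoldGeometry.LieDual EG G),
      (∀ (γ : OrbifoldGeometry.DeckGroup E p) (x : Mt),
        Jt (γ.1 x) - Jt x = Multiplicative.toAdd (h γ)) ∧
      (OrbifoldGeometry.IsCoadjointEquivariant Jt →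
        ∀ γ, Multiplicative.toAdd (h γ) ∈ OrbifoldGeometry.derivedAnnihilator EG G)) ∧
    (IsCompl (OrbifoldGeometry.derivedAlg EG G) (OrbifoldGeometry.lieRadical EG G) →
      Function.Bijective (OrbifoldGeometry.restrictToRadical EG G)) ∧
    (LieAlgebra.HasTrivialRadical ℝ (GroupLieAlgebra 𝓘(ℝ, EG) G) →
      ∃ J : M → OrbifoldGeometry.LieDual EG G,
        OrbifoldGeometry.IsMomentumMap σ J ∧ Jt = J ∘ p ∧
        (OrbifoldGeometry.IsCoadjointEquivariant Jt →
          OrbifoldGeometry.IsCoadjointEquivariant J)) := by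
  have hconn : ConnectedSpace Mt := hp.connected
  have hcov := hp.covering
  have hinvt : OrbifoldGeometry.IsInvariantForm G σt := fun g =>
    OrbifoldGeometry.isPullback_of_comp_eq hσt hcov.smooth (hM.orbifoldSmooth g⁻¹) (hinv g⁻¹) <| by
      funext x
      simp [hlift]
  -- Stated for every map over the base, since it is applied both to deck transformations and to the
  -- covering maps `r` below.
  have hover : ∀ f : Mt → Mt, (∀ x, p (f x) = p x) →
      OrbifoldGeometry.IsPullback f σt.toFun σt.toFun := fun f hf =>
    OrbifoldGeometry.isPullback_of_comp_eq hσt hcov.smooth OrbifoldGeometry.orbifoldSmooth_id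
      σ.compatible (funext hf)
  obtain ⟨x₀⟩ : Nonempty Mt := inferInstance
  have hdeck : ∀ (γ : OrbifoldGeometry.DeckGroup E p) (x : Mt),
      Jt (γ.1 x) - Jt x = Jt (γ.1 x₀) - Jt x₀ := fun γ x =>
    hJt.comp_sub_eq_const_of_commute hMt γ.2.1 γ.1.isOpenMap (hover _ γ.2.2.2)
      (hcomm γ.1 γ.2) x x₀
  refine ⟨⟨MonoidHom.mk' (fun γ => Multiplicative.ofAdd (Jt (γ.1 x₀) - Jt x₀)) ?_, hdeck, ?_⟩,
    OrbifoldGeometry.restrictToRadical_bijective, ?_⟩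
  · intro γ δ
    -- The displacement of `γ` is evaluated at `δ x₀`, so that the sum telescopes.
    rw [← ofAdd_add, ← hdeck γ (δ.1 x₀), sub_add_sub_cancel]
    rfl
  · intro _ γ
    exact OrbifoldGeometry.mem_derivedAnnihilator_of_Ad_invariant
      (hJt.comp_sub_Ad_invariant hMt hinvt γ.2.1 γ.1.isOpenMap (hover _ γ.2.2.2)
        (hcomm γ.1 γ.2) x₀)
  · intro hrad
    have hfib : ∀ x x', p x = p x' → Jt x = Jt x' := by
      refine fun x x' => hcov.momentum_eq_of_fiber hJt fun x x' hxx' hreg => ?_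
      -- Universality is applied to the covering `p` itself, with the two points of the fibre as
      -- base points.
      obtain ⟨r, hr, hpr, rfl⟩ := hp.universal Mt p hcov x x' hxx' hreg
      have hpr' : ∀ x, p (r x) = p x := congrFun hpr
      have hmem := OrbifoldGeometry.mem_derivedAnnihilator_of_Ad_invariant
        (hJt.comp_sub_Ad_invariant hMt hinvt hr.smooth hr.isOpenMap (hover r hpr')
          (hcov.map_smul hMt hlift hr.smooth.continuous hpr') x)
      rw [OrbifoldGeometry.derivedAnnihilator, OrbifoldGeometry.derivedAlg_eq_top,
        LieSubmodule.top_toSubmodule, Submodule.dualAnnihilator_top, Submodule.mem_bot,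
        sub_eq_zero] at hmem
      exact hmem.symm
    have hsurj := hcov.surjective
    have hJp : (fun y => Jt (Function.surjInv hsurj y)) ∘ p = Jt :=
      funext fun x => hfib _ _ (Function.surjInv_eq hsurj (p x))
    refine ⟨fun y => Jt (Function.surjInv hsurj y), ?_, hJp.symm, ?_⟩
    · exact OrbifoldGeometry.IsMomentumMap.descend hcov hsurj hMt hlift hσt (by rwa [hJp])
    · intro hequiv g y
      obtain ⟨x, rfl⟩ := hsurj y
      rw [← hlift]
      exact (congrFun hJp (g • x)).trans ((hequiv g x).trans
        (congrArg (OrbifoldGeometry.coAd g) (congrFun hJp x).symm))
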